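/- **Theorem.** Let $\alpha\in(0,1)$, $c=1/\sum_{k\ge 0}e^{-k^\alpha}$, and let $X_1,X_2,\dots$ be i.i.d. random variables with values in $\mathbb N_0=\{0,1,2,\dots\}$ and law $\mathbb P(X_i=k)=c\,e^{-k^\alpha}$ for $k\in\mathbb N_0$. Let $\mu=\mathbb E[X_1]$, let $\sigma^2$ be the variance of $X_1$, let $S_n=X_1+\cdots+X_n$ and $\gamma=\frac1{2-\alpha}$. Let $s\in\mathbb R$ and let $(s_n)_{n\ge 1}$ be a sequence of real numbers with $s_n\to s$ and $\mu n+s_nn^\gamma\in\mathbb N_0$ for all $n\ge1$. Let $X_{[1:n]}\ge X_{[2:n]}\ge\cdots\ge X_{[n:n]}$ be the decreasing rearrangement of $X_1,\dots,X_n$, and put $X_{[j:n]}=0$ for $j\ge n+1$. Let $\mathcal D\subset[0,\infty)^{\mathbb N}$ be the space of decreasing (i.e. non-increasing) sequences $x_1\ge x_2\ge\cdots\ge 0$, with the subspace topology of the product topology, and define $F_s:\mathcal D\to[0,\infty]$ by $$F_s(x)=\sum_{j=1}^\infty x_j^\alpha+\frac1{2\sigma^2}\Bigl(s-\sum_{j=1}^\infty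 x_j\Bigr)^2,$$ where the second term is $\infty$ if $\sum_j x_j=\infty$. Put $I_s=F_s-\inf_{\mathcal D}F_s$. Let $\mathbb Q_{n,s_n}$ be the distribution of $\bigl(X_{[j:n]}/n^\gamma\bigr)_{j\in\mathbb N}$ on $\mathcal D$ under the conditional law $\mathbb P(\,\cdot\mid S_n=\mu n+s_nn^\gamma)$. Then $(\mathbb Q_{n,s_n})_{n\ge 1}$ satisfies the large deviation principle with speed $n^{\gamma\alpha}$ (which tends to $\infty$) and good rate function $I_s$. That is, $I_s$ is lower semicontinuous with compact sublevel sets $\{x\in\mathcal D: I_s(x)\le a\}$, $a\in[0,\infty)$; for every closed set $\mathcal A\subset\mathcal D$, $$\limsup_{n\to\infty}\frac1{n^{\gamma\alpha}}\log\mathbb Q_{n,s_n}(\mathcal A)\le-\inf_{\mathcal A}I_s;$$ and for every open set $\mathcal O\subset\mathcal D$, $$\liminf_{n\to\infty}\frac1{n^{\gamma\alpha}}\log\mathbb Q_{n,s_n}(\mathcal O)\ge-\inf_{\mathcal O}I_s,$$ with the conventions $\log 0=-\infty$ and $\inf\emptyset=\infty$. -/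

import Mathlib

open MeasureTheory ProbabilityTheory Filter Topology
open scoped NNReal ENNReal

noncomputable section

/-- The sequence of measures `Q` on `E` satisfies the large deviation principle with speed `v`
and good rate function `I`. Logarithms, `limsup`, `liminf` and infima are taken in `[-∞, ∞]`,
with `log 0 = -∞` and `inf ∅ = ∞`. -/
structure SatisfiesLDP {E : Type*} [TopologicalSpace E] [MeasurableSpace E]
    (Q : ℕ → Measure E) (v : ℕ → ℝ) (I : E → ℝ≥0∞) : Prop where
  speed_tendsto : Tendsto v atTop atTop
  lowerSemicontinuous : LowerSemicontinuous I
  isCompact_sublevel : ∀ a : ℝ≥0, IsCompact {x | I x ≤ (a : ℝ≥0∞)}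
  upper_bound : ∀ A : Set E, IsClosed A →
    limsup (fun n => ((1 / v n : ℝ) : EReal) * ENNReal.log (Q n A)) atTop
      ≤ -(⨅ x ∈ A, (I x : EReal))
  lower_bound : ∀ O : Set E, IsOpen O →
    -(⨅ x ∈ O, (I x : EReal))
      ≤ liminf (fun n => ((1 / v n : ℝ) : EReal) * ENNReal.log (Q n O)) atTop

/-- Decreasing sequences of nonnegative reals (indexed from `0`), with the subspace topology of
the product topology and the corresponding σ-algebra. -/
abbrev DecSeq : Type := {x : ℕ → ℝ≥0 // Antitone x}

/-- The function `F_s(x) = ∑ x_j^α + (s - ∑ x_j)² / (2σ²)`, with values in `[0, ∞]`;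
the parameter `v` is the variance `σ²`. The second term is `∞` when `∑ x_j = ∞`. -/
def energy (α v s : ℝ) (x : DecSeq) : ℝ≥0∞ :=
  (∑' j, (x.1 j : ℝ≥0∞) ^ α) +
    if (∑' j, (x.1 j : ℝ≥0∞)) = ⊤ then ⊤
    else ENNReal.ofReal ((s - (∑' j, (x.1 j : ℝ≥0∞)).toReal) ^ 2 / (2 * v))

/-- The `j`-th entry, counted from `j = 0`, of the tuple `x` rearranged in decreasing order;
it is `0` for `j ≥ n`. -/
def revOrderStat {n : ℕ} (x : Fin n → ℕ) (j : ℕ) : ℕ :=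
  if h : j < n then x (Tuple.sort x (Fin.rev ⟨j, h⟩)) else 0

theorem revOrderStat_antitone {n : ℕ} (x : Fin n → ℕ) : Antitone (revOrderStat x) := by
  intro j k hjk
  by_cases hk : k < n
  · have hj : j < n := lt_of_le_of_lt hjk hk
    simp only [revOrderStat, hk, hj, dif_pos]
    exact Tuple.monotone_sort x (Fin.rev_le_rev.mpr hjk)
  · simp [revOrderStat, hk]

/-- The sequence of reversed order statistics of `x`, divided by `n ^ γ`. -/
def scaledOrderStats (γ : ℝ) {n : ℕ} (x : Fin n → ℕ) : DecSeq :=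
  ⟨fun j => (revOrderStat x j : ℝ≥0) / (n : ℝ≥0) ^ γ, fun _ _ h => by
    have h' : (revOrderStat x _ : ℝ≥0) ≤ revOrderStat x _ :=
      Nat.cast_le.mpr (revOrderStat_antitone x h)
    exact div_le_div_of_nonneg_right h' (zero_le)⟩

end

/-! Write `V = n ^ (γ * α)` and `r = n ^ γ`. A single variable of size `y * r` costs `V * y ^ α`. A
deviation `u * r` spread over all variables has the Gaussian cost `(u * r) ^ 2 / (2 * v * n) = V * u
^ 2 / (2 * v)`, because `2 * γ = 1 + γ * α`. So finitely many big jumps and one moderate deviation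
of the bulk compete at the same speed. The unconditional probability that the sum is prescribed and
the order statistics are near `x` is roughly `exp (-V * F_s(x))`.

Upper bound (`IsStretchedExpLaw.exists_nhd_measure_le`): choose the positions of the `K` largest
variables, at a cost of `n ^ K`, which is negligible at speed `V`. Bound these variables by their
tails, and the rest by an exponential Chebyshev inequality with tilt `t * r / n`. The moment
generating function is infinite without truncation. On `[0, δ * r]`, however, the tilt is at most
half of `k ^ α` as soon as `t * δ ^ (1 - α) ≤ 1 / 2`, and then only the variance matters
(`IsStretchedExpLaw.tendsto_log_truncMGF`). The resulting exponent is `minorant`, and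
`exists_lt_minorant` shows that `t` and `K` can be chosen to bring it above any level below the
energy. Compactness and exponential tightness of the maximum extend the bound to closed sets.

Lower bound (`IsStretchedExpLaw.measure_open_ge`): approximate `x` by a sequence of finite support,
prescribe the first variables, let the bulk make a moderate deviation
(`IsStretchedExpLaw.measure_window_ge`), and use one further variable of small cost to hit the total
exactly (`measure_prescribed_sum_ge`).

Both bounds on the whole space show that the conditioning event has rate `inf F_s`. Dividing by its
probability subtracts this infimum. -/

/-! ### Expansion of the truncated moment generating function -/

/-- Taylor's formula for `|y| ≤ 1`, crude domination by the cubic otherwise. The factor `exp (max y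
0)` makes the bound valid for all `y`; it is later absorbed by half of the weight `exp (-k ^ α)`. -/
theorem abs_exp_sub_quadratic_le (y : ℝ) :
    |Real.exp y - (1 + y + y ^ 2 / 2)| ≤ 3 * |y| ^ 3 * Real.exp (max y 0) := by
  have hexp : 1 ≤ Real.exp (max y 0) := Real.one_le_exp (le_max_right _ _)
  rcases le_total (|y|) 1 with h | h
  · have := Real.exp_bound h (n := 3) (by norm_num)
    simp only [Finset.sum_range_succ, Finset.sum_range_zero, Nat.factorial, Nat.cast_one, Nat.cast_ofNat] at this
    norm_num at this
    have h2 : |y| ^ 3 * (2 / 9) ≤ 3 * |y| ^ 3 * Real.exp (max y 0) := by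
      nlinarith [pow_nonneg (abs_nonneg y) 3]
    refine le_trans (le_of_eq ?_) (this.trans h2)
    congr 1
  · rcases le_total y 0 with h0 | h0
    · have h1 : Real.exp y ≤ 1 := Real.exp_le_one_iff.mpr h0
      have h3 := Real.exp_pos y
      rw [abs_of_nonpos h0] at h
      rw [max_eq_right h0, Real.exp_zero, mul_one, abs_of_nonpos h0]
      have : y ^ 2 ≥ 1 := by nlinarith
      rw [abs_le]
      constructor <;> nlinarith
    · have h1 := Real.quadratic_le_exp_of_nonneg h0
      rw [abs_of_nonneg h0] at *
      rw [max_eq_left h0, abs_of_nonneg (by linarith)]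
      have : 1 ≤ y ^ 3 := one_le_pow₀ h
      nlinarith [Real.exp_pos y]

theorem summable_add_pow_mul_exp_neg_rpow {α κ : ℝ} (hα : 0 < α) (hκ : 0 < κ) (m : ℝ) (j : ℕ) :
    Summable fun k : ℕ => ((k : ℝ) + m) ^ j * Real.exp (-κ * (k : ℝ) ^ α) := by
  have hk : Tendsto (fun k : ℕ => (k : ℝ) ^ α) atTop atTop :=
    (tendsto_rpow_atTop hα).comp tendsto_natCast_atTop_atTop
  -- The exponent is chosen so that the product with `k ^ j` is `k ^ (-2)`.
  have h1 := ((isLittleO_exp_neg_mul_rpow_atTop hκ (-((j : ℝ) + 2) / α)).comp_tendsto hk).isBigO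
  have h2 : (fun k : ℕ => ((k : ℝ) + m) ^ j) =O[atTop] fun k : ℕ => (k : ℝ) ^ j := by
    refine Asymptotics.IsBigO.pow ?_ j
    refine (Asymptotics.isBigO_refl _ _).add ?_
    exact ((Asymptotics.isLittleO_const_id_atTop m).comp_tendsto tendsto_natCast_atTop_atTop).isBigO
  have h3 := h2.mul h1
  refine summable_of_isBigO_nat (Real.summable_one_div_nat_rpow.mpr (by norm_num : (1 : ℝ) < 2)) ?_
  refine h3.trans (Asymptotics.IsBigO.of_bound 1 ?_)
  filter_upwards [eventually_gt_atTop 0] with k hk0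
  have hk' : (0 : ℝ) < k := by exact_mod_cast hk0
  simp only [Function.comp]
  rw [← Real.rpow_mul hk'.le, mul_div_cancel₀ _ hα.ne', ← Real.rpow_natCast, ← Real.rpow_add hk', one_mul]
  rw [one_div, ← Real.rpow_neg hk'.le]
  apply le_of_eq; congr 2; ring

/-- The weights `c * exp (-k ^ α)` form a probability mass function on `ℕ` with mean `μ` and
variance `v > 0`. -/
structure IsStretchedExpLaw (α c μ v : ℝ) : Prop where
  alpha_pos : 0 < α
  alpha_lt_one : α < 1
  c_pos : 0 < c
  var_pos : 0 < v
  mass : HasSum (fun k : ℕ => c * Real.exp (-(k : ℝ) ^ α)) 1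
  mean : HasSum (fun k : ℕ => c * Real.exp (-(k : ℝ) ^ α) * (k - μ)) 0
  var : HasSum (fun k : ℕ => c * Real.exp (-(k : ℝ) ^ α) * (k - μ) ^ 2) v

/-- The moment generating function at `θ` of the centred law restricted to `[0, B]`. -/
noncomputable def truncMGF (α c μ B θ : ℝ) : ℝ :=
  ∑' k : ℕ, if (k : ℝ) ≤ B then c * Real.exp (-(k : ℝ) ^ α) * Real.exp (θ * (k - μ)) else 0

theorem summable_truncMGF (α c μ B θ : ℝ) :
    Summable fun k : ℕ =>
      if (k : ℝ) ≤ B then c * Real.exp (-(k : ℝ) ^ α) * Real.exp (θ * (k - μ)) else 0 := by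
  refine summable_of_ne_finset_zero (s := Finset.range (⌊B⌋₊ + 1)) fun k hk => if_neg ?_
  intro h
  simp only [Finset.mem_range, not_lt] at hk
  have := Nat.le_floor h
  omega

/-- Compare term by term with the untruncated series of the quadratic Taylor polynomial, whose sum
is exact since the law is centred. Below `B` the cubic remainder appears, with its exponential
factor controlled by the hypothesis on `θ * k`. Above `B` the missing quadratic terms are charged to
`((k + M) / B) ^ 3 ≥ 1`. -/
theorem IsStretchedExpLaw.abs_truncMGF_sub_le {α c μ v : ℝ} (h : IsStretchedExpLaw α c μ v) :
    ∃ C : ℝ, 0 ≤ C ∧ ∀ θ B : ℝ, |θ| ≤ 1 → 0 < B →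
      (∀ k : ℕ, (k : ℝ) ≤ B → θ * k ≤ (k : ℝ) ^ α / 2) →
      |truncMGF α c μ B θ - (1 + θ ^ 2 * v / 2)| ≤ C * (|θ| ^ 3 + B⁻¹ ^ 3) := by
  set M : ℝ := |μ| + 1
  -- One majorant for both ranges: the power `5 = 2 + 3` is the quadratic polynomial times the cubic
  -- factor inserted above `B`, and it also dominates the cubic remainder.
  set g : ℕ → ℝ := fun k => c * (3 * Real.exp |μ| + 1) *
    (((k : ℝ) + M) ^ 5 * Real.exp (-(1 / 2) * (k : ℝ) ^ α)) with hg
  have hc := h.c_pos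
  have hgs : Summable g :=
    (summable_add_pow_mul_exp_neg_rpow h.alpha_pos (by norm_num) M 5).mul_left _
  have hM1 : 1 ≤ M := by simp [M]
  refine ⟨∑' k, g k, tsum_nonneg fun k => by positivity, fun θ B hθ hB hle => ?_⟩
  have hb : HasSum (fun k : ℕ => c * Real.exp (-(k : ℝ) ^ α) *
      (1 + θ * (k - μ) + (θ * (k - μ)) ^ 2 / 2)) (1 + θ ^ 2 * v / 2) := by
    convert (h.mass.add (h.mean.mul_left θ)).add (h.var.mul_left (θ ^ 2 / 2)) using 1
    · ext k; ring
    · ring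
  have hd := (summable_truncMGF α c μ B θ).hasSum.sub hb
  have hmaj := hgs.hasSum.mul_right (|θ| ^ 3 + B⁻¹ ^ 3)
  have key : ∀ k : ℕ, ‖(if (k : ℝ) ≤ B then c * Real.exp (-(k : ℝ) ^ α) * Real.exp (θ * (k - μ)) else 0)
      - c * Real.exp (-(k : ℝ) ^ α) * (1 + θ * (k - μ) + (θ * (k - μ)) ^ 2 / 2)‖ ≤
      g k * (|θ| ^ 3 + B⁻¹ ^ 3) := by
    intro k
    have hk0 : (0 : ℝ) ≤ k := Nat.cast_nonneg k
    have hkα : 0 ≤ (k : ℝ) ^ α := by positivity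
    have habs : |(k : ℝ) - μ| ≤ k + M := by
      have := abs_sub (k : ℝ) μ
      rw [abs_of_nonneg hk0] at this
      simp only [M]; linarith
    have hkM : 1 ≤ (k : ℝ) + M := by linarith
    have hyabs : |θ * (k - μ)| = |θ| * |(k : ℝ) - μ| := abs_mul _ _
    have hBi : 0 ≤ B⁻¹ := by positivity
    rw [Real.norm_eq_abs]
    split_ifs with hkB
    · rw [← mul_sub, abs_mul, abs_of_pos (by positivity)]
      have hT := abs_exp_sub_quadratic_le (θ * (k - μ))
      have hmax : max (θ * (k - μ)) 0 ≤ (k : ℝ) ^ α / 2 + |μ| := by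
        have h1 := hle k hkB
        have h2 : -(θ * μ) ≤ |μ| := by
          calc -(θ * μ) ≤ |θ * μ| := neg_le_abs _
            _ = |θ| * |μ| := abs_mul _ _
            _ ≤ 1 * |μ| := by gcongr
            _ = |μ| := one_mul _
        refine max_le ?_ (by positivity)
        linarith
      have h3 : |θ * (k - μ)| ^ 3 ≤ |θ| ^ 3 * (k + M) ^ 5 := by
        rw [hyabs, mul_pow]
        gcongr
        calc |(k : ℝ) - μ| ^ 3 ≤ (k + M) ^ 3 := by gcongr
          _ ≤ (k + M) ^ 5 := pow_le_pow_right₀ hkM (by norm_num)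
      have hE : Real.exp (-(k : ℝ) ^ α) * Real.exp ((k : ℝ) ^ α / 2 + |μ|) =
          Real.exp |μ| * Real.exp (-(1 / 2) * (k : ℝ) ^ α) := by
        rw [← Real.exp_add, ← Real.exp_add]; congr 1; ring
      calc c * Real.exp (-(k : ℝ) ^ α) * |Real.exp (θ * (k - μ)) - (1 + θ * (k - μ) + (θ * (k - μ)) ^ 2 / 2)|
          ≤ c * Real.exp (-(k : ℝ) ^ α) * (3 * (|θ| ^ 3 * (k + M) ^ 5) * Real.exp ((k : ℝ) ^ α / 2 + |μ|)) := by
            gcongr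
            refine hT.trans ?_
            gcongr
        _ = c * 3 * (|θ| ^ 3 * (k + M) ^ 5) * (Real.exp (-(k : ℝ) ^ α) * Real.exp ((k : ℝ) ^ α / 2 + |μ|)) := by ring
        _ = c * (3 * Real.exp |μ|) * (((k : ℝ) + M) ^ 5 * Real.exp (-(1 / 2) * (k : ℝ) ^ α)) * (|θ| ^ 3) := by
            rw [hE]; ring
        _ ≤ g k * (|θ| ^ 3 + B⁻¹ ^ 3) := by
            simp only [hg]
            gcongr
            · linarith
            · exact le_add_of_nonneg_right (by positivity)
    · rw [zero_sub, abs_neg, abs_mul, abs_of_pos (by positivity)]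
      have h1 : |1 + θ * (k - μ) + (θ * (k - μ)) ^ 2 / 2| ≤ (k + M) ^ 2 := by
        have hy : |θ * (k - μ)| ≤ k + M - 1 := by
          have : |(k : ℝ) - μ| ≤ k + M - 1 := by
            have := abs_sub (k : ℝ) μ
            rw [abs_of_nonneg hk0] at this
            simp only [M]; linarith
          rw [hyabs]
          calc |θ| * |(k : ℝ) - μ| ≤ 1 * |(k : ℝ) - μ| := by gcongr
            _ ≤ _ := by linarith
        have hy2 : (θ * (k - μ)) ^ 2 ≤ (k + M - 1) ^ 2 := sq_le_sq' (by linarith [abs_le.mp hy]) (abs_le.mp hy).2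
        have := abs_le.mp hy
        rw [abs_le]
        constructor <;> nlinarith
      have h2 : 1 ≤ (k + M) ^ 3 * B⁻¹ ^ 3 := by
        rw [← mul_pow]
        refine one_le_pow₀ ?_
        rw [← div_eq_mul_inv, one_le_div hB]
        push Not at hkB; linarith
      calc c * Real.exp (-(k : ℝ) ^ α) * |1 + θ * (k - μ) + (θ * (k - μ)) ^ 2 / 2|
          ≤ c * Real.exp (-(1 / 2) * (k : ℝ) ^ α) * ((k + M) ^ 2 * ((k + M) ^ 3 * B⁻¹ ^ 3)) := by
            gcongr
            · linarith
            · exact h1.trans (le_mul_of_one_le_right (by positivity) h2)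
        _ = c * 1 * (((k : ℝ) + M) ^ 5 * Real.exp (-(1 / 2) * (k : ℝ) ^ α)) * (B⁻¹ ^ 3) := by ring
        _ ≤ g k * (|θ| ^ 3 + B⁻¹ ^ 3) := by
            simp only [hg]
            gcongr
            · linarith [Real.exp_pos |μ|]
            · exact le_add_of_nonneg_left (by positivity)
  have hfin := tsum_of_norm_bounded hmaj key
  rw [hd.tsum_eq, Real.norm_eq_abs] at hfin
  exact hfin

/-! ### The scales `n ^ γ` and `n ^ (γ * α)` -/

section Scales

variable {α γ : ℝ}

theorem gamma_pos (hα1 : α < 1) (hγ : γ = 1 / (2 - α)) : 0 < γ := by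
  rw [hγ]; apply one_div_pos.mpr; linarith

theorem gamma_lt_one (hα1 : α < 1) (hγ : γ = 1 / (2 - α)) : γ < 1 := by
  rw [hγ, div_lt_one] <;> linarith

theorem natCast_rpow_rpow (n : ℕ) : ((n : ℝ) ^ γ) ^ α = (n : ℝ) ^ (γ * α) :=
  (Real.rpow_mul (Nat.cast_nonneg n) γ α).symm

/-- This is `2 * γ = 1 + γ * α`, the defining property of `γ`: it equates the orders of the Gaussian
cost `r ^ 2 / n` and of the jump cost `r ^ α`. -/
theorem scale_mul_self (hα1 : α < 1) (hγ : γ = 1 / (2 - α)) {n : ℕ} (hn : 0 < n) :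
    (n : ℝ) ^ γ * (n : ℝ) ^ γ = n * (n : ℝ) ^ (γ * α) := by
  have hn' : (0 : ℝ) < n := by exact_mod_cast hn
  rw [← Real.rpow_add hn']
  have : n * (n : ℝ) ^ (γ * α) = (n : ℝ) ^ (1 + γ * α) := by
    rw [Real.rpow_add hn', Real.rpow_one]
  rw [this]
  congr 1
  rw [hγ]
  have : 2 - α ≠ 0 := by linarith
  field_simp
  ring

theorem tendsto_scale (hα1 : α < 1) (hγ : γ = 1 / (2 - α)) :
    Tendsto (fun n : ℕ => (n : ℝ) ^ γ) atTop atTop :=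
  (tendsto_rpow_atTop (gamma_pos hα1 hγ)).comp tendsto_natCast_atTop_atTop

theorem tendsto_speed (hα0 : 0 < α) (hα1 : α < 1) (hγ : γ = 1 / (2 - α)) :
    Tendsto (fun n : ℕ => (n : ℝ) ^ (γ * α)) atTop atTop :=
  (tendsto_rpow_atTop (mul_pos (gamma_pos hα1 hγ) hα0)).comp tendsto_natCast_atTop_atTop

theorem tendsto_scale_div (hα1 : α < 1) (hγ : γ = 1 / (2 - α)) :
    Tendsto (fun n : ℕ => (n : ℝ) ^ γ / n) atTop (𝓝 0) := by
  have h1 : Tendsto (fun n : ℕ => (n : ℝ) ^ (-(1 - γ))) atTop (𝓝 0) :=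
    (tendsto_rpow_neg_atTop (by linarith [gamma_lt_one hα1 hγ])).comp tendsto_natCast_atTop_atTop
  refine h1.congr' ?_
  filter_upwards [eventually_gt_atTop 0] with n hn
  have hn' : (0 : ℝ) < n := by exact_mod_cast hn
  rw [neg_sub, Real.rpow_sub_one hn'.ne']

theorem tendsto_log_div_speed (hα0 : 0 < α) (hα1 : α < 1) (hγ : γ = 1 / (2 - α)) :
    Tendsto (fun n : ℕ => Real.log n / (n : ℝ) ^ (γ * α)) atTop (𝓝 0) :=
  ((isLittleO_log_rpow_atTop (mul_pos (gamma_pos hα1 hγ) hα0)).tendsto_div_nhds_zero).comp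
    tendsto_natCast_atTop_atTop

theorem tendsto_natCast_sub_div (K : ℕ) :
    Tendsto (fun n : ℕ => ((n - K : ℕ) : ℝ) / n) atTop (𝓝 1) := by
  have h : Tendsto (fun n : ℕ => 1 - (K : ℝ) / n) atTop (𝓝 (1 - 0)) :=
    tendsto_const_nhds.sub (tendsto_const_div_atTop_nhds_zero_nat _)
  rw [sub_zero] at h
  refine h.congr' ?_
  filter_upwards [eventually_gt_atTop 0, eventually_ge_atTop K] with n hn hK
  have hn' : (0 : ℝ) < n := by exact_mod_cast hn
  rw [Nat.cast_sub hK]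
  field_simp

/-- On `[0, η n ^ γ]` the linear tilt `t n ^ (γ - 1) k` is at most half of `k ^ α`. -/
theorem tilt_mul_le (hα1 : α < 1) (hγ : γ = 1 / (2 - α)) {η t : ℝ} (hη : 0 < η)
    (ht : t * η ^ (1 - α) ≤ 1 / 2) {n : ℕ} (hn : 0 < n) (k : ℕ)
    (hk : (k : ℝ) ≤ η * (n : ℝ) ^ γ) :
    t * ((n : ℝ) ^ γ / n) * k ≤ (k : ℝ) ^ α / 2 := by
  have hn' : (0 : ℝ) < n := by exact_mod_cast hn
  set r := (n : ℝ) ^ γ with hr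
  have hr0 : 0 < r := by positivity
  have hkα : 0 ≤ (k : ℝ) ^ α := by positivity
  rcases Nat.eq_zero_or_pos k with rfl | hk0
  · rw [Nat.cast_zero, mul_zero]
    positivity
  rcases le_total t 0 with ht0 | ht0
  · have : t * (r / n) * k ≤ 0 :=
      mul_nonpos_of_nonpos_of_nonneg (mul_nonpos_of_nonpos_of_nonneg ht0 (by positivity)) (by positivity)
    linarith
  have hk' : (0 : ℝ) < k := by exact_mod_cast hk0
  have hsplit : (k : ℝ) = (k : ℝ) ^ α * (k : ℝ) ^ (1 - α) := by
    rw [← Real.rpow_add hk']; simp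
  have hle : (k : ℝ) ^ (1 - α) ≤ η ^ (1 - α) * r ^ (1 - α) := by
    rw [← Real.mul_rpow hη.le hr0.le]
    exact Real.rpow_le_rpow hk'.le hk (by linarith)
  have hone : r / n * r ^ (1 - α) = 1 := by
    have h1 := scale_mul_self hα1 hγ hn
    rw [← natCast_rpow_rpow, ← hr] at h1
    rw [Real.rpow_sub hr0, Real.rpow_one]
    have : 0 < r ^ α := by positivity
    field_simp
    linarith [h1, pow_two r]
  calc t * (r / n) * k = t * (r / n) * ((k : ℝ) ^ α * (k : ℝ) ^ (1 - α)) := by rw [← hsplit]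
    _ ≤ t * (r / n) * ((k : ℝ) ^ α * (η ^ (1 - α) * r ^ (1 - α))) := by gcongr
    _ = (k : ℝ) ^ α * (t * η ^ (1 - α)) * (r / n * r ^ (1 - α)) := by ring
    _ = (k : ℝ) ^ α * (t * η ^ (1 - α)) := by rw [hone, mul_one]
    _ ≤ (k : ℝ) ^ α * (1 / 2) := by gcongr
    _ = _ := by ring

end Scales

/-! ### Logarithmic asymptotics under the critical tilt -/

theorem truncMGF_pos {α c μ B : ℝ} (hc : 0 < c) (hB : 0 ≤ B) (θ : ℝ) : 0 < truncMGF α c μ B θ := by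
  refine (summable_truncMGF α c μ B θ).tsum_pos (fun k => ?_) 0 ?_
  · split_ifs <;> positivity
  · rw [if_pos (by simpa using hB)]; positivity

/-- With `θ = t * r / n` one has `n * θ ^ 2 = t ^ 2 * V`, while the cubic error divided by `V` is of
order `r / n` plus a negative power of `n`. The logarithm is squeezed by `1 - 1 / φ ≤ log φ ≤ φ -
1`. Removing `K` of the `n` factors does not change the limit. -/
theorem IsStretchedExpLaw.tendsto_log_truncMGF {α c μ v γ : ℝ} (h : IsStretchedExpLaw α c μ v)
    (hγ : γ = 1 / (2 - α)) {η t : ℝ} (hη : 0 < η) (ht : t * η ^ (1 - α) ≤ 1 / 2) (K : ℕ) :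
    Tendsto (fun n : ℕ => ((n - K : ℕ) : ℝ) / (n : ℝ) ^ (γ * α) *
      Real.log (truncMGF α c μ (η * (n : ℝ) ^ γ) (t * ((n : ℝ) ^ γ / n)))) atTop
      (𝓝 (t ^ 2 * v / 2)) := by
  obtain ⟨C, hC, hbound⟩ := h.abs_truncMGF_sub_le
  have hα1 := h.alpha_lt_one
  set φ : ℕ → ℝ := fun n => truncMGF α c μ (η * (n : ℝ) ^ γ) (t * ((n : ℝ) ^ γ / n)) with hφ
  have hφpos : ∀ n, 0 < φ n := fun n => truncMGF_pos h.c_pos (by positivity) _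
  have hrn := tendsto_scale_div hα1 hγ
  have hr := tendsto_scale hα1 hγ
  have hV := tendsto_speed h.alpha_pos hα1 hγ
  have hsmall : ∀ᶠ n : ℕ in atTop, |t * ((n : ℝ) ^ γ / n)| ≤ 1 := by
    have : Tendsto (fun n : ℕ => |t * ((n : ℝ) ^ γ / n)|) atTop (𝓝 |t * 0|) :=
      (hrn.const_mul t).abs
    rw [mul_zero, abs_zero] at this
    exact this.eventually_le_const one_pos
  have herr : Tendsto (fun n : ℕ => C * (|t| ^ 3 * ((n : ℝ) ^ γ / n) +
      η⁻¹ ^ 3 * (((n : ℝ) ^ (γ * α))⁻¹ ^ 2 * ((n : ℝ) ^ γ)⁻¹))) atTop (𝓝 0) := by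
    have := ((hrn.const_mul (|t| ^ 3)).add
      (((hV.inv_tendsto_atTop.pow 2).mul hr.inv_tendsto_atTop).const_mul (η⁻¹ ^ 3))).const_mul C
    simpa using this
  have hx : Tendsto (fun n : ℕ => (n : ℝ) / (n : ℝ) ^ (γ * α) * (φ n - 1)) atTop
      (𝓝 (t ^ 2 * v / 2)) := by
    rw [tendsto_iff_norm_sub_tendsto_zero]
    refine squeeze_zero' (Eventually.of_forall fun _ => norm_nonneg _) ?_ herr
    filter_upwards [hsmall, eventually_gt_atTop 0] with n hn hn0
    have hn' : (0 : ℝ) < n := by exact_mod_cast hn0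
    have hb := hbound _ (η * (n : ℝ) ^ γ) hn (by positivity) (tilt_mul_le hα1 hγ hη ht hn0)
    have hsq := scale_mul_self hα1 hγ hn0
    simp only [hφ]
    set r := (n : ℝ) ^ γ
    set V := (n : ℝ) ^ (γ * α)
    have hr0 : 0 < r := by positivity
    have hV0 : 0 < V := by positivity
    have hVe : V = r * r / n := by rw [hsq]; field_simp
    have e1 : (n : ℝ) / V * (truncMGF α c μ (η * r) (t * (r / n)) - 1) - t ^ 2 * v / 2 =
        (n : ℝ) / V * (truncMGF α c μ (η * r) (t * (r / n)) - (1 + (t * (r / n)) ^ 2 * v / 2)) := by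
      rw [hVe]; field_simp; ring
    rw [e1, Real.norm_eq_abs, abs_mul, abs_of_pos (by positivity : 0 < (n : ℝ) / V)]
    refine (mul_le_mul_of_nonneg_left hb (by positivity)).trans (le_of_eq ?_)
    rw [abs_mul, abs_of_pos (by positivity : 0 < r / n), hVe]
    field_simp
  have hVn : Tendsto (fun n : ℕ => (n : ℝ) ^ (γ * α) / n) atTop (𝓝 0) := by
    have := hrn.pow 2
    rw [zero_pow two_ne_zero] at this
    refine this.congr' ?_
    filter_upwards [eventually_gt_atTop 0] with n hn0
    have hn' : (0 : ℝ) < n := by exact_mod_cast hn0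
    have hsq := scale_mul_self hα1 hγ hn0
    rw [div_pow, pow_two ((n : ℝ) ^ γ), hsq]
    field_simp
  have hφ1 : Tendsto φ atTop (𝓝 1) := by
    have := (hVn.mul hx).add_const 1
    rw [zero_mul, zero_add] at this
    refine this.congr' ?_
    filter_upwards [eventually_gt_atTop 0] with n hn0
    have hn' : (0 : ℝ) < n := by exact_mod_cast hn0
    field_simp
    ring
  have hlog : Tendsto (fun n : ℕ => (n : ℝ) / (n : ℝ) ^ (γ * α) * Real.log (φ n)) atTop
      (𝓝 (t ^ 2 * v / 2)) := by
    have hlow : Tendsto (fun n : ℕ => (n : ℝ) / (n : ℝ) ^ (γ * α) * (φ n - 1) * (φ n)⁻¹) atTop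
        (𝓝 (t ^ 2 * v / 2)) := by
      simpa using hx.mul (hφ1.inv₀ one_ne_zero)
    refine tendsto_of_tendsto_of_tendsto_of_le_of_le hlow hx (fun n => ?_) fun n => ?_
    · dsimp only
      rw [mul_assoc]
      refine mul_le_mul_of_nonneg_left ?_ (by positivity)
      have := Real.one_sub_inv_le_log_of_pos (hφpos n)
      rwa [sub_mul, mul_inv_cancel₀ (hφpos n).ne', one_mul]
    · exact mul_le_mul_of_nonneg_left (Real.log_le_sub_one_of_pos (hφpos n)) (by positivity)
  have := (tendsto_natCast_sub_div K).mul hlog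
  rw [one_mul] at this
  refine this.congr' ?_
  filter_upwards [eventually_gt_atTop 0] with n hn0
  have hn' : (0 : ℝ) < n := by exact_mod_cast hn0
  change _ = _ * Real.log (φ n)
  field_simp

/-! ### Exponential estimates for independent truncated variables -/

section Independent

variable {Ω : Type*} [MeasurableSpace Ω] {P : Measure Ω} {α c μ : ℝ} {X : ℕ → Ω → ℕ}

theorem measurableSet_forall_mem (R : Finset ℕ) {p : ℕ → Ω → Prop}
    (hp : ∀ i, MeasurableSet {ω | p i ω}) : MeasurableSet {ω | ∀ i ∈ R, p i ω} := by
  have : {ω | ∀ i ∈ R, p i ω} = ⋂ i ∈ R, {ω | p i ω} := by ext; simp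
  rw [this]
  exact R.measurableSet_biInter fun i _ => hp i

theorem lintegral_comp_of_law (hX : ∀ i, Measurable (X i))
    (hlaw : ∀ i k, P {ω | X i ω = k} = ENNReal.ofReal (c * Real.exp (-(k : ℝ) ^ α)))
    (g : ℕ → ℝ≥0∞) (i : ℕ) :
    ∫⁻ ω, g (X i ω) ∂P = ∑' k : ℕ, g k * ENNReal.ofReal (c * Real.exp (-(k : ℝ) ^ α)) := by
  rw [← lintegral_map (μ := P) (f := g) (measurable_of_countable g) (hX i), lintegral_countable']
  refine tsum_congr fun k => ?_
  rw [Measure.map_apply (hX i) (measurableSet_singleton k), ← hlaw i k]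
  rfl

theorem lintegral_prod_comp (hX : ∀ i, Measurable (X i)) (hindep : iIndepFun X P)
    (s : Finset ℕ) (g : ℕ → ℕ → ℝ≥0∞) :
    ∫⁻ ω, ∏ i ∈ s, g i (X i ω) ∂P = ∏ i ∈ s, ∫⁻ ω, g i (X i ω) ∂P := by
  have h := hindep.comp g fun i => measurable_of_countable _
  have := lintegral_prod_eq_prod_lintegral_of_indepFun s (fun i => g i ∘ X i) h
    fun i => (measurable_of_countable (g i)).comp (hX i)
  simpa using this

theorem lintegral_trunc_tilt (hc : 0 < c) (hX : ∀ i, Measurable (X i))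
    (hlaw : ∀ i k, P {ω | X i ω = k} = ENNReal.ofReal (c * Real.exp (-(k : ℝ) ^ α)))
    (B θ : ℝ) (i : ℕ) :
    ∫⁻ ω, (if (X i ω : ℝ) ≤ B then ENNReal.ofReal (Real.exp (θ * (X i ω - μ))) else 0) ∂P =
      ENNReal.ofReal (truncMGF α c μ B θ) := by
  rw [lintegral_comp_of_law hX hlaw
    (fun k => if (k : ℝ) ≤ B then ENNReal.ofReal (Real.exp (θ * (k - μ))) else 0) i, truncMGF,
    ENNReal.ofReal_tsum_of_nonneg (fun k => by split_ifs <;> positivity)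
      (summable_truncMGF α c μ B θ)]
  refine tsum_congr fun k => ?_
  split_ifs
  · rw [← ENNReal.ofReal_mul (by positivity), mul_comm]
  · simp

/-- Giving up the fraction `κ` of the exponent leaves a summable series, so a uniform constant
replaces sharp tail asymptotics. -/
theorem tail_le (hc : 0 < c) (hα0 : 0 < α) (hX : ∀ i, Measurable (X i))
    (hlaw : ∀ i k, P {ω | X i ω = k} = ENNReal.ofReal (c * Real.exp (-(k : ℝ) ^ α)))
    {κ : ℝ} (hκ0 : 0 < κ) (hκ1 : κ < 1) (a : ℝ) (i : ℕ) :
    ∫⁻ ω, (if a ≤ (X i ω : ℝ) then 1 else 0) ∂P ≤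
      ENNReal.ofReal ((∑' k : ℕ, c * Real.exp (-κ * (k : ℝ) ^ α)) *
        Real.exp (-(1 - κ) * (max a 0) ^ α)) := by
  have hs : Summable fun k : ℕ => c * Real.exp (-κ * (k : ℝ) ^ α) := by
    simpa using (summable_add_pow_mul_exp_neg_rpow hα0 hκ0 0 0).mul_left c
  rw [lintegral_comp_of_law hX hlaw (fun k => if a ≤ (k : ℝ) then 1 else 0) i, ← tsum_mul_right,
    ENNReal.ofReal_tsum_of_nonneg (fun k => by positivity) (hs.mul_right _)]
  refine ENNReal.tsum_le_tsum fun k => ?_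
  split_ifs with hk
  · rw [one_mul]
    apply ENNReal.ofReal_le_ofReal
    rw [mul_assoc, ← Real.exp_add]
    gcongr
    have : (max a 0) ^ α ≤ (k : ℝ) ^ α :=
      Real.rpow_le_rpow (le_max_right _ _) (max_le hk (Nat.cast_nonneg k)) hα0.le
    nlinarith
  · simp

theorem lintegral_trunc_tilt_sum (hc : 0 < c) (hX : ∀ i, Measurable (X i)) (hindep : iIndepFun X P)
    (hlaw : ∀ i k, P {ω | X i ω = k} = ENNReal.ofReal (c * Real.exp (-(k : ℝ) ^ α)))
    {B : ℝ} (hB : 0 ≤ B) (θ : ℝ) (R : Finset ℕ) :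
    ∫⁻ ω, ∏ i ∈ R, (if (X i ω : ℝ) ≤ B then ENNReal.ofReal (Real.exp (θ * (X i ω - μ))) else 0) ∂P =
      ENNReal.ofReal (truncMGF α c μ B θ ^ R.card) := by
  rw [lintegral_prod_comp hX hindep R
    fun _ k => if (k : ℝ) ≤ B then ENNReal.ofReal (Real.exp (θ * (k - μ))) else 0]
  simp_rw [lintegral_trunc_tilt hc hX hlaw]
  rw [Finset.prod_const, ENNReal.ofReal_pow (truncMGF_pos hc hB θ).le]

theorem prod_trunc_tilt (x : ℕ → ℕ) (B θ μ : ℝ) (R : Finset ℕ) :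
    ∏ i ∈ R, (if (x i : ℝ) ≤ B then ENNReal.ofReal (Real.exp (θ * (x i - μ))) else 0) =
      if ∀ i ∈ R, (x i : ℝ) ≤ B then ENNReal.ofReal (Real.exp (θ * ∑ i ∈ R, ((x i : ℝ) - μ))) else 0 := by
  split_ifs with h
  · rw [Finset.mul_sum, Real.exp_sum, ENNReal.ofReal_prod_of_nonneg fun i _ => (Real.exp_pos _).le]
    exact Finset.prod_congr rfl fun i hi => if_pos (h i hi)
  · push Not at h
    obtain ⟨i, hi, hlt⟩ := h
    exact Finset.prod_eq_zero hi (if_neg (not_le.mpr hlt))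

/-- Exponential Chebyshev bound: the variables in `J` are large, those in `R` are at most `B` and
have a large tilted sum. -/
theorem measure_large_and_trunc_le (hc : 0 < c) (hα0 : 0 < α) (hX : ∀ i, Measurable (X i))
    (hindep : iIndepFun X P)
    (hlaw : ∀ i k, P {ω | X i ω = k} = ENNReal.ofReal (c * Real.exp (-(k : ℝ) ^ α)))
    {κ : ℝ} (hκ0 : 0 < κ) (hκ1 : κ < 1) {B : ℝ} (hB : 0 ≤ B) (θ w : ℝ) (a : ℕ → ℝ)
    {J R : Finset ℕ} (hJR : Disjoint J R) :
    P {ω | (∀ i ∈ J, a i ≤ X i ω) ∧ (∀ i ∈ R, (X i ω : ℝ) ≤ B) ∧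
        w ≤ θ * ∑ i ∈ R, ((X i ω : ℝ) - μ)} ≤
      ENNReal.ofReal (Real.exp (-w) * ((∏ i ∈ J, (∑' k : ℕ, c * Real.exp (-κ * (k : ℝ) ^ α)) *
        Real.exp (-(1 - κ) * (max (a i) 0) ^ α)) * truncMGF α c μ B θ ^ R.card)) := by
  -- A single family of factors, an indicator on `J` and a truncated exponential on `R`, so that
  -- independence is used only once.
  set g : ℕ → ℕ → ℝ≥0∞ := fun i k => if i ∈ J then (if a i ≤ (k : ℝ) then 1 else 0) else
    if (k : ℝ) ≤ B then ENNReal.ofReal (Real.exp (θ * (k - μ))) else 0 with hg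
  have hgJ : ∀ i ∈ J, ∀ k : ℕ, g i k = if a i ≤ (k : ℝ) then 1 else 0 := fun i hi k => by
    simp [hg, hi]
  have hgR : ∀ i ∈ R, ∀ k : ℕ,
      g i k = if (k : ℝ) ≤ B then ENNReal.ofReal (Real.exp (θ * (k - μ))) else 0 :=
    fun i hi k => by simp [hg, Finset.disjoint_right.mp hJR hi]
  have hpt : ∀ ω, ({ω | (∀ i ∈ J, a i ≤ X i ω) ∧ (∀ i ∈ R, (X i ω : ℝ) ≤ B) ∧
        w ≤ θ * ∑ i ∈ R, ((X i ω : ℝ) - μ)}.indicator 1 ω : ℝ≥0∞) ≤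
      ENNReal.ofReal (Real.exp (-w)) * ∏ i ∈ J ∪ R, g i (X i ω) := by
    intro ω
    refine Set.indicator_apply_le' (fun hω => ?_) fun _ => zero_le
    obtain ⟨h1, h2, h3⟩ := hω
    rw [Finset.prod_union hJR, Finset.prod_congr rfl fun i hi => hgJ i hi (X i ω),
      Finset.prod_congr rfl fun i hi => hgR i hi (X i ω), prod_trunc_tilt (fun i => X i ω), if_pos h2,
      Finset.prod_eq_one fun i hi => if_pos (h1 i hi), one_mul, ← ENNReal.ofReal_mul (by positivity),
      ← Real.exp_add]
    simp only [Pi.one_apply, ENNReal.one_le_ofReal]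
    apply Real.one_le_exp
    linarith
  have hmeas : MeasurableSet {ω | (∀ i ∈ J, a i ≤ X i ω) ∧ (∀ i ∈ R, (X i ω : ℝ) ≤ B) ∧
        w ≤ θ * ∑ i ∈ R, ((X i ω : ℝ) - μ)} := by
    have hXr : ∀ i, Measurable fun ω => (X i ω : ℝ) := fun i =>
      (measurable_of_countable (fun k : ℕ => (k : ℝ))).comp (hX i)
    exact (measurableSet_forall_mem J fun i => measurableSet_le measurable_const (hXr i)).inter
      ((measurableSet_forall_mem R fun i => measurableSet_le (hXr i) measurable_const).inter
        (measurableSet_le measurable_const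
          ((Finset.measurable_sum R fun i _ => (hXr i).sub_const μ).const_mul θ)))
  rw [← lintegral_indicator_one hmeas]
  refine (lintegral_mono hpt).trans ?_
  have hXg : Measurable fun ω => ∏ i ∈ J ∪ R, g i (X i ω) :=
    Finset.measurable_prod _ fun i _ => (measurable_of_countable (g i)).comp (hX i)
  rw [lintegral_const_mul _ hXg, ENNReal.ofReal_mul (by positivity)]
  gcongr
  rw [lintegral_prod_comp hX hindep, Finset.prod_union hJR,
    ENNReal.ofReal_mul (Finset.prod_nonneg fun i _ =>
      mul_nonneg (tsum_nonneg fun k => by positivity) (by positivity)),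
    ENNReal.ofReal_prod_of_nonneg fun i _ =>
      mul_nonneg (tsum_nonneg fun k => by positivity) (by positivity)]
  refine mul_le_mul' (Finset.prod_le_prod' fun i hi => ?_) (le_of_eq ?_)
  · simp_rw [hgJ i hi]
    exact tail_le hc hα0 hX hlaw hκ0 hκ1 (a i) i
  · rw [ENNReal.ofReal_pow (truncMGF_pos hc hB θ).le, ← Finset.prod_const]
    refine Finset.prod_congr rfl fun i hi => ?_
    simp_rw [hgR i hi]
    exact lintegral_trunc_tilt hc hX hlaw B θ i

/-- Change of measure: the tilted mass outside `[a, b]` is controlled by two further tilts. -/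
theorem truncMGF_pow_le [IsProbabilityMeasure P] (hc : 0 < c) (hX : ∀ i, Measurable (X i))
    (hindep : iIndepFun X P)
    (hlaw : ∀ i k, P {ω | X i ω = k} = ENNReal.ofReal (c * Real.exp (-(k : ℝ) ^ α)))
    {B : ℝ} (hB : 0 ≤ B) {θ τ w a b : ℝ} (hτ : 0 ≤ τ) (hw : ∀ z, a ≤ z → z ≤ b → θ * z ≤ w)
    (R : Finset ℕ) :
    truncMGF α c μ B θ ^ R.card ≤
      Real.exp w * P.real {ω | (∀ i ∈ R, (X i ω : ℝ) ≤ B) ∧ a ≤ ∑ i ∈ R, ((X i ω : ℝ) - μ) ∧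
        ∑ i ∈ R, ((X i ω : ℝ) - μ) ≤ b} +
      Real.exp (-(τ * b)) * truncMGF α c μ B (θ + τ) ^ R.card +
      Real.exp (τ * a) * truncMGF α c μ B (θ - τ) ^ R.card := by
  set S := {ω | (∀ i ∈ R, (X i ω : ℝ) ≤ B) ∧ a ≤ ∑ i ∈ R, ((X i ω : ℝ) - μ) ∧
        ∑ i ∈ R, ((X i ω : ℝ) - μ) ≤ b} with hS
  have hXr : ∀ i, Measurable fun ω => (X i ω : ℝ) := fun i =>
    (measurable_of_countable (fun k : ℕ => (k : ℝ))).comp (hX i)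
  have hsum : Measurable fun ω => ∑ i ∈ R, ((X i ω : ℝ) - μ) :=
    Finset.measurable_sum R fun i _ => (hXr i).sub_const μ
  have hmeas : MeasurableSet S :=
    (measurableSet_forall_mem R fun i => measurableSet_le (hXr i) measurable_const).inter
      ((measurableSet_le measurable_const hsum).inter (measurableSet_le hsum measurable_const))
  set G : ℝ → Ω → ℝ≥0∞ := fun θ ω => ∏ i ∈ R,
    (if (X i ω : ℝ) ≤ B then ENNReal.ofReal (Real.exp (θ * (X i ω - μ))) else 0) with hG
  have hGm : ∀ θ, Measurable (G θ) := fun θ => Finset.measurable_prod _ fun i _ =>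
    (measurable_of_countable fun k : ℕ =>
      if (k : ℝ) ≤ B then ENNReal.ofReal (Real.exp (θ * (k - μ))) else 0).comp (hX i)
  have hpt : ∀ ω, G θ ω ≤ ENNReal.ofReal (Real.exp w) * S.indicator 1 ω +
      ENNReal.ofReal (Real.exp (-(τ * b))) * G (θ + τ) ω +
      ENNReal.ofReal (Real.exp (τ * a)) * G (θ - τ) ω := by
    intro ω
    simp only [hG, prod_trunc_tilt (fun i => X i ω)]
    split_ifs with h
    · set z := ∑ i ∈ R, ((X i ω : ℝ) - μ) with hz
      simp only [← ENNReal.ofReal_mul (Real.exp_pos _).le, ← Real.exp_add]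
      -- Left of `a`, `θ * z ≤ τ * a + (θ - τ) * z`; right of `b`, `θ * z ≤ -τ * b + (θ + τ) * z`;
      -- inside the window `w` bounds the tilt.
      rcases lt_or_ge z a with hza | hza
      · refine le_add_left (ENNReal.ofReal_le_ofReal (Real.exp_le_exp.mpr ?_))
        nlinarith
      rcases lt_or_ge b z with hzb | hzb
      · refine le_add_right (le_add_left (ENNReal.ofReal_le_ofReal (Real.exp_le_exp.mpr ?_)))
        nlinarith
      · have hωS : ω ∈ S := ⟨h, hza, hzb⟩
        rw [Set.indicator_of_mem hωS, Pi.one_apply, mul_one]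
        exact le_add_right (le_add_right (ENNReal.ofReal_le_ofReal (Real.exp_le_exp.mpr (hw z hza hzb))))
    · exact zero_le
  have hmono := lintegral_mono (μ := P) hpt
  rw [lintegral_add_right _ ((hGm _).const_mul _), lintegral_add_right _ ((hGm _).const_mul _),
    lintegral_const_mul _ (measurable_one.indicator hmeas), lintegral_const_mul _ (hGm _),
    lintegral_const_mul _ (hGm _), lintegral_indicator_one hmeas] at hmono
  simp only [hG, lintegral_trunc_tilt_sum hc hX hindep hlaw hB] at hmono
  have hφ := fun θ' => (pow_pos (truncMGF_pos (α := α) (μ := μ) hc hB θ') R.card).le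
  rw [← ofReal_measureReal (μ := P) (s := S), ← ENNReal.ofReal_mul (Real.exp_pos _).le,
    ← ENNReal.ofReal_mul (Real.exp_pos _).le, ← ENNReal.ofReal_mul (Real.exp_pos _).le,
    ← ENNReal.ofReal_add (by positivity) (mul_nonneg (Real.exp_pos _).le (hφ _)),
    ← ENNReal.ofReal_add (add_nonneg (by positivity) (mul_nonneg (Real.exp_pos _).le (hφ _)))
      (mul_nonneg (Real.exp_pos _).le (hφ _))] at hmono
  refine (ENNReal.ofReal_le_ofReal_iff ?_).mp hmono
  exact add_nonneg (add_nonneg (by positivity) (mul_nonneg (Real.exp_pos _).le (hφ _)))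
      (mul_nonneg (Real.exp_pos _).le (hφ _))

end Independent

/-! ### Order statistics and sorting -/

section OrderStatistics

theorem exists_perm_revOrderStat {n : ℕ} (x : Fin n → ℕ) :
    ∃ ρ : Equiv.Perm (Fin n), ∀ j, x (ρ j) = revOrderStat x j :=
  ⟨Fin.revPerm.trans (Tuple.sort x), fun j => by simp [revOrderStat]⟩

/-- The `K` largest entries of a tuple, together with their positions. -/
theorem exists_positions_of_largest {n K : ℕ} (hK : 1 ≤ K) (hKn : K ≤ n) (x : Fin n → ℕ) :
    ∃ e : Fin K → Fin n, Function.Injective e ∧ (∀ j, x (e j) = revOrderStat x j) ∧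
      ∀ i, (∀ j, e j ≠ i) → x i ≤ revOrderStat x (K - 1) := by
  obtain ⟨ρ, hρ⟩ := exists_perm_revOrderStat x
  refine ⟨fun j => ρ (Fin.castLE hKn j), fun a b h => ?_, fun j => by simp [hρ], fun i hi => ?_⟩
  · exact Fin.castLE_injective hKn (ρ.injective h)
  · have hge : K ≤ (ρ.symm i : ℕ) := by
      by_contra hlt
      push Not at hlt
      exact hi ⟨ρ.symm i, hlt⟩ (by simp)
    rw [← ρ.apply_symm_apply i, hρ]
    exact revOrderStat_antitone x (by omega)

theorem not_perm_Iic_subset_Iio {n : ℕ} (ρ : Equiv.Perm (Fin n)) (j : Fin n)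
    (h : ∀ i ≤ j, ρ i < j) : False := by
  have := Finset.card_le_card_of_injOn (s := Finset.Iic j) (t := Finset.Iio j) ρ
    (fun i hi => by simpa using h i (by simpa using hi)) ρ.injective.injOn
  simp at this

/-- Sorting does not increase the uniform distance to a decreasing sequence. -/
theorem abs_revOrderStat_sub_le {n : ℕ} (x : Fin n → ℕ) {y : ℕ → ℝ} (hy : Antitone y) {η : ℝ}
    (h : ∀ i : Fin n, |(x i : ℝ) - y i| ≤ η) (j : Fin n) : |(revOrderStat x j : ℝ) - y j| ≤ η := by
  obtain ⟨ρ, hρ⟩ := exists_perm_revOrderStat x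
  rw [abs_le]
  constructor
  · by_contra hlt
    push Not at hlt
    refine not_perm_Iic_subset_Iio ρ.symm j fun i hi => ?_
    by_contra hge
    push Not at hge
    have h1 : x i ≤ revOrderStat x j := by
      rw [← ρ.apply_symm_apply i, hρ]
      exact revOrderStat_antitone x hge
    have h2 : (x i : ℝ) ≤ revOrderStat x j := by exact_mod_cast h1
    have h3 := (abs_le.mp (h i)).1
    have h4 : y j ≤ y i := hy hi
    linarith
  · by_contra hlt
    push Not at hlt
    refine not_perm_Iic_subset_Iio ρ j fun i hi => ?_
    by_contra hge
    push Not at hge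
    have h1 : revOrderStat x j ≤ x (ρ i) := by
      rw [hρ]
      exact revOrderStat_antitone x hi
    have h2 : (revOrderStat x j : ℝ) ≤ x (ρ i) := by exact_mod_cast h1
    have h3 := (abs_le.mp (h (ρ i))).2
    have h4 : y (ρ i) ≤ y j := hy hge
    linarith

theorem coe_scaledOrderStats (γ : ℝ) {n : ℕ} (x : Fin n → ℕ) (j : ℕ) :
    (((scaledOrderStats γ x).1 j : ℝ≥0) : ℝ) = revOrderStat x j / (n : ℝ) ^ γ := by
  simp [scaledOrderStats]

end OrderStatistics

/-! ### The energy: finite-dimensional minorants, compactness, approximation -/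

section Energy

variable {α v s : ℝ}

/-- A finite-dimensional minorant of the energy: the quadratic is replaced by its tangent with
slope `t` and the sums are restricted to the first `K` terms. -/
noncomputable def minorant (α v s t : ℝ) (K : ℕ) (x : DecSeq) : ℝ :=
  ∑ j ∈ Finset.range K, (x.1 j : ℝ) ^ α + t * (s - ∑ j ∈ Finset.range K, (x.1 j : ℝ)) - t ^ 2 * v / 2

theorem energy_eq_ofReal (hα0 : 0 < α) (hv : 0 < v) {x : DecSeq}
    (h1 : Summable fun j => (x.1 j : ℝ) ^ α) (h2 : Summable fun j => (x.1 j : ℝ)) :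
    energy α v s x =
      ENNReal.ofReal (∑' j, (x.1 j : ℝ) ^ α + (s - ∑' j, (x.1 j : ℝ)) ^ 2 / (2 * v)) := by
  have e1 : (∑' j, (x.1 j : ℝ≥0∞) ^ α) = ENNReal.ofReal (∑' j, (x.1 j : ℝ) ^ α) := by
    rw [ENNReal.ofReal_tsum_of_nonneg (fun j => by positivity) h1]
    refine tsum_congr fun j => ?_
    rw [← ENNReal.ofReal_rpow_of_nonneg (x.1 j).coe_nonneg hα0.le, ENNReal.ofReal_coe_nnreal]
  have e2 : (∑' j, (x.1 j : ℝ≥0∞)) = ENNReal.ofReal (∑' j, (x.1 j : ℝ)) := by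
    rw [ENNReal.ofReal_tsum_of_nonneg (fun j => by positivity) h2]
    simp
  have h0 : 0 ≤ ∑' j, (x.1 j : ℝ) := tsum_nonneg fun j => by positivity
  rw [energy, e1, e2, if_neg ENNReal.ofReal_ne_top, ENNReal.toReal_ofReal h0,
    ← ENNReal.ofReal_add (tsum_nonneg fun j => by positivity) (by positivity)]

theorem summable_of_energy_ne_top (hα0 : 0 < α) {x : DecSeq} (h : energy α v s x ≠ ⊤) :
    (Summable fun j => (x.1 j : ℝ) ^ α) ∧ Summable fun j => (x.1 j : ℝ) := by
  rw [energy] at h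
  have h1 := (ENNReal.add_ne_top.mp h).1
  have h2 : (∑' j, (x.1 j : ℝ≥0∞)) ≠ ⊤ := fun ht => by simp [ht] at h
  constructor
  · have : (∑' j, ((x.1 j ^ α : ℝ≥0) : ℝ≥0∞)) ≠ ⊤ := by
      convert h1 using 3 with j
      rw [ENNReal.coe_rpow_of_nonneg _ hα0.le]
    have := NNReal.summable_coe.mpr (ENNReal.tsum_coe_ne_top_iff_summable.mp this)
    simpa using this
  · exact NNReal.summable_coe.mpr (ENNReal.tsum_coe_ne_top_iff_summable.mp h2)

/-- A square lies above its tangents, `z ^ 2 / (2 * v) ≥ t * z - t ^ 2 * v / 2`. The terms beyond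
`K` can be dropped because `t * y ≤ y ^ α` for each of them: by monotonicity `y` is at most the
entry at `K - 1`. -/
theorem ofReal_minorant_le_energy (hα0 : 0 < α) (hα1 : α < 1) (hv : 0 < v) {t : ℝ} {K : ℕ}
    {x : DecSeq} (ht : t * (x.1 (K - 1) : ℝ) ^ (1 - α) ≤ 1) :
    ENNReal.ofReal (minorant α v s t K x) ≤ energy α v s x := by
  by_cases htop : energy α v s x = ⊤
  · rw [htop]; exact le_top
  obtain ⟨h1, h2⟩ := summable_of_energy_ne_top hα0 htop
  rw [energy_eq_ofReal hα0 hv h1 h2]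
  apply ENNReal.ofReal_le_ofReal
  have hs1 := h1.sum_add_tsum_nat_add K
  have hs2 := h2.sum_add_tsum_nat_add K
  have htail : t * ∑' j, (x.1 (j + K) : ℝ) ≤ ∑' j, (x.1 (j + K) : ℝ) ^ α := by
    rw [← tsum_mul_left]
    refine Summable.tsum_le_tsum (fun j => ?_) (((summable_nat_add_iff K).mpr h2).mul_left t)
      ((summable_nat_add_iff K).mpr h1)
    have hle : (x.1 (j + K) : ℝ) ≤ x.1 (K - 1) := by exact_mod_cast x.2 (by omega)
    set y : ℝ := (x.1 (j + K) : ℝ)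
    have hy0 : 0 ≤ y := (x.1 (j + K)).coe_nonneg
    rcases hy0.eq_or_lt with hy | hy
    · rw [← hy, mul_zero]; positivity
    rcases le_total t 0 with ht0 | ht0
    · exact (mul_nonpos_of_nonpos_of_nonneg ht0 hy0).trans (by positivity)
    have hsplit : y = y ^ α * y ^ (1 - α) := by rw [← Real.rpow_add hy]; simp
    calc t * y = y ^ α * (t * y ^ (1 - α)) := by nth_rewrite 1 [hsplit]; ring
      _ ≤ y ^ α * (t * (x.1 (K - 1) : ℝ) ^ (1 - α)) := by
          gcongr
      _ ≤ y ^ α * 1 := by gcongr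
      _ = y ^ α := mul_one _
  have hsq : t * (s - ∑' j, (x.1 j : ℝ)) - t ^ 2 * v / 2 ≤ (s - ∑' j, (x.1 j : ℝ)) ^ 2 / (2 * v) := by
    rw [le_div_iff₀ (by positivity)]
    nlinarith [sq_nonneg (s - ∑' j, (x.1 j : ℝ) - t * v)]
  rw [minorant]
  rw [← hs1]
  rw [← hs2] at hsq ⊢
  linarith

theorem summable_of_summable_rpow (hα0 : 0 < α) (hα1 : α < 1) {x : ℕ → ℝ≥0}
    (h : Summable fun j => (x j : ℝ) ^ α) : Summable fun j => (x j : ℝ) := by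
  have h0 := h.tendsto_atTop_zero
  refine h.of_norm_bounded_eventually_nat ?_
  filter_upwards [h0.eventually_le_const one_pos] with j hj
  rw [Real.norm_of_nonneg (x j).coe_nonneg]
  have hx0 : 0 ≤ (x j : ℝ) := (x j).coe_nonneg
  have hx1 : (x j : ℝ) ≤ 1 := by
    by_contra hlt
    push Not at hlt
    exact absurd hj (not_le.mpr (Real.one_lt_rpow hlt hα0))
  simpa using Real.rpow_le_rpow_of_exponent_ge' hx0 hx1 hα0.le hα1.le

/-- If the powers are summable, take the tangent at the actual defect, `t = (s - ∑ x) / v`, and let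
`K` grow; the entries tend to `0`, which gives the constraint on `t`. Otherwise `t = 0` and a large
partial sum suffice. The constant `1 / 2` is what the truncated tilt requires later. -/
theorem exists_lt_minorant (hα0 : 0 < α) (hα1 : α < 1) (hv : 0 < v) {x : DecSeq} {L : ℝ}
    (hL : ENNReal.ofReal L < energy α v s x) (hL0 : 0 ≤ L) :
    ∃ t : ℝ, ∃ K : ℕ, 1 ≤ K ∧ t * (x.1 (K - 1) : ℝ) ^ (1 - α) < 1 / 2 ∧ L < minorant α v s t K x := by
  by_cases h1 : Summable fun j => (x.1 j : ℝ) ^ α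
  · have h2 := summable_of_summable_rpow hα0 hα1 h1
    rw [energy_eq_ofReal hα0 hv h1 h2, ENNReal.ofReal_lt_ofReal_iff_of_nonneg hL0] at hL
    set t := (s - ∑' j, (x.1 j : ℝ)) / v with ht
    have hlim : Tendsto (fun K => minorant α v s t K x) atTop
        (𝓝 (∑' j, (x.1 j : ℝ) ^ α + t * (s - ∑' j, (x.1 j : ℝ)) - t ^ 2 * v / 2)) :=
      (h1.hasSum.tendsto_sum_nat.add
        ((h2.hasSum.tendsto_sum_nat.const_sub s).const_mul t)).sub_const _
    have heq : ∑' j, (x.1 j : ℝ) ^ α + t * (s - ∑' j, (x.1 j : ℝ)) - t ^ 2 * v / 2 =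
        ∑' j, (x.1 j : ℝ) ^ α + (s - ∑' j, (x.1 j : ℝ)) ^ 2 / (2 * v) := by
      rw [ht]; field_simp; ring
    rw [heq] at hlim
    have hx : Tendsto (fun K => t * (x.1 (K - 1) : ℝ) ^ (1 - α)) atTop (𝓝 0) := by
      have h3 := (h2.tendsto_atTop_zero.comp (tendsto_sub_atTop_nat 1)).rpow_const
        (p := 1 - α) (Or.inr (by linarith))
      rw [Real.zero_rpow (by linarith)] at h3
      simpa using h3.const_mul t
    obtain ⟨K, hK1, hK2, hK3⟩ := ((eventually_ge_atTop 1).and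
      ((hx.eventually_lt_const (by norm_num : (0 : ℝ) < 1 / 2)).and
        (hlim.eventually_const_lt hL))).exists
    exact ⟨t, K, hK1, hK2, hK3⟩
  · have hdiv := (not_summable_iff_tendsto_nat_atTop_of_nonneg fun j => by positivity).mp h1
    obtain ⟨K, hK1, hK2⟩ := ((eventually_ge_atTop 1).and (hdiv.eventually_gt_atTop L)).exists
    refine ⟨0, K, hK1, by norm_num, ?_⟩
    simpa [minorant] using hK2

theorem continuous_coe_apply (j : ℕ) : Continuous fun x : DecSeq => (x.1 j : ℝ) :=
  NNReal.continuous_coe.comp ((continuous_apply j).comp continuous_subtype_val)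

/-- The map `x ↦ ∑ x_j` is not continuous in the product topology, but each `minorant` is, and the
constraint making it a lower bound persists near `x`. -/
theorem isClosed_energy_le (hα0 : 0 < α) (hα1 : α < 1) (hv : 0 < v) (b : ℝ≥0∞) :
    IsClosed {x : DecSeq | energy α v s x ≤ b} := by
  rcases eq_or_ne b ⊤ with rfl | hb
  · simp
  rw [← isOpen_compl_iff, isOpen_iff_mem_nhds]
  intro x hx
  have hx' : ENNReal.ofReal b.toReal < energy α v s x := by
    rw [ENNReal.ofReal_toReal hb]; simpa using hx
  obtain ⟨t, K, -, hK, hlt⟩ := exists_lt_minorant hα0 hα1 hv hx' ENNReal.toReal_nonneg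
  have hc1 : ContinuousAt (fun y : DecSeq => t * (y.1 (K - 1) : ℝ) ^ (1 - α)) x :=
    (((continuous_coe_apply (K - 1)).rpow_const fun _ => Or.inr (by linarith)).const_mul t).continuousAt
  have hc2 : ContinuousAt (fun y : DecSeq => minorant α v s t K y) x := by
    refine Continuous.continuousAt ?_
    unfold minorant
    exact ((continuous_finsetSum _ fun j _ => (continuous_coe_apply j).rpow_const
      fun _ => Or.inr hα0.le).add (Continuous.const_mul (continuous_const.sub
      (continuous_finsetSum _ fun j _ => continuous_coe_apply j)) t)).sub continuous_const
  filter_upwards [hc1.eventually_lt_const hK, hc2.eventually_const_lt hlt] with y hy1 hy2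
  simp only [Set.mem_compl_iff, Set.mem_ofPred_eq, not_le]
  refine lt_of_lt_of_le ?_ (ofReal_minorant_le_energy hα0 hα1 hv (hy1.le.trans (by norm_num)))
  rw [← ENNReal.ofReal_toReal hb]
  exact (ENNReal.ofReal_lt_ofReal_iff_of_nonneg ENNReal.toReal_nonneg).mpr hy2

/-- For decreasing sequences a bound on the first entry bounds all of them, so Tychonoff applies. -/
theorem isCompact_apply_zero_le (M : ℝ≥0) : IsCompact {x : DecSeq | x.1 0 ≤ M} := by
  rw [Subtype.isCompact_iff]
  have hbox : IsCompact (Set.univ.pi fun _ : ℕ => Set.Icc (0 : ℝ≥0) M) :=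
    isCompact_univ_pi fun _ => isCompact_Icc
  have hclosed : IsClosed {x : ℕ → ℝ≥0 | Antitone x} := by
    have : {x : ℕ → ℝ≥0 | Antitone x} = ⋂ i, ⋂ j, ⋂ _ : i ≤ j, {x | x j ≤ x i} := by
      ext; simp [Antitone]
    rw [this]
    exact isClosed_iInter fun i => isClosed_iInter fun j => isClosed_iInter fun _ =>
      isClosed_le (continuous_apply j) (continuous_apply i)
  refine (hbox.inter_right hclosed).of_isClosed_subset ?_ ?_
  · have : Subtype.val '' {x : DecSeq | x.1 0 ≤ M} = {x : ℕ → ℝ≥0 | Antitone x} ∩ {x | x 0 ≤ M} := by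
      ext x; simp [and_comm]
    rw [this]
    exact hclosed.inter (isClosed_le (continuous_apply 0) continuous_const)
  · rintro _ ⟨x, hx, rfl⟩
    exact ⟨fun j _ => ⟨zero_le, (x.2 (Nat.zero_le j)).trans hx⟩, x.2⟩

theorem isCompact_energy_le (hα0 : 0 < α) (hα1 : α < 1) (hv : 0 < v) {b : ℝ≥0∞} (hb : b ≠ ⊤) :
    IsCompact {x : DecSeq | energy α v s x ≤ b} := by
  lift b to ℝ≥0 using hb
  refine (isCompact_apply_zero_le (b ^ α⁻¹)).of_isClosed_subset (isClosed_energy_le hα0 hα1 hv _) ?_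
  intro x hx
  have h1 : (x.1 0 : ℝ≥0∞) ^ α ≤ b :=
    ((ENNReal.le_tsum 0).trans le_self_add).trans hx
  rw [← ENNReal.coe_rpow_of_nonneg _ hα0.le, ENNReal.coe_le_coe] at h1
  exact (NNReal.le_rpow_inv_iff hα0).mpr h1

theorem iInf_energy_ne_top (hα0 : 0 < α) (hv : 0 < v) : ⨅ y, energy α v s y ≠ ⊤ := by
  refine ne_top_of_le_ne_top ?_ (iInf_le _ (⟨fun _ => 0, fun _ _ _ => le_rfl⟩ : DecSeq))
  rw [energy_eq_ofReal hα0 hv]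
  · exact ENNReal.ofReal_ne_top
  · simp [Real.zero_rpow hα0.ne', summable_zero]
  · simp [summable_zero]

/-- Sequences of finite support approximate the energy from above. -/
theorem exists_truncation_lt (hα0 : 0 < α) (hv : 0 < v) {x : DecSeq} {L : ℝ}
    (hL : energy α v s x < ENNReal.ofReal L) {O : Set DecSeq} (hO : IsOpen O) (hx : x ∈ O) :
    ∃ y ∈ O, ∃ K : ℕ, (∀ j, K ≤ j → y.1 j = 0) ∧
      ∑ j ∈ Finset.range K, (y.1 j : ℝ) ^ α +
        (s - ∑ j ∈ Finset.range K, (y.1 j : ℝ)) ^ 2 / (2 * v) < L := by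
  obtain ⟨h1, h2⟩ := summable_of_energy_ne_top hα0 hL.ne_top
  rw [energy_eq_ofReal hα0 hv h1 h2, ENNReal.ofReal_lt_ofReal_iff_of_nonneg
    (add_nonneg (tsum_nonneg fun j => by positivity) (by positivity))] at hL
  set y : ℕ → DecSeq := fun K => ⟨fun j => if j < K then x.1 j else 0, fun i j hij => by
    dsimp only
    split_ifs with h h'
    · exact x.2 hij
    · omega
    · exact zero_le
    · exact le_rfl⟩ with hy
  have hyx : Tendsto y atTop (𝓝 x) := by
    rw [tendsto_subtype_rng, tendsto_pi_nhds]
    intro j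
    refine tendsto_const_nhds.congr' ?_
    filter_upwards [eventually_gt_atTop j] with K hK
    simp [hy, hK]
  have hlim : Tendsto (fun K => ∑ j ∈ Finset.range K, (x.1 j : ℝ) ^ α +
        (s - ∑ j ∈ Finset.range K, (x.1 j : ℝ)) ^ 2 / (2 * v)) atTop
        (𝓝 (∑' j, (x.1 j : ℝ) ^ α + (s - ∑' j, (x.1 j : ℝ)) ^ 2 / (2 * v))) :=
    h1.hasSum.tendsto_sum_nat.add (((h2.hasSum.tendsto_sum_nat.const_sub s).pow 2).div_const _)
  obtain ⟨K, hK1, hK2⟩ := ((hyx.eventually (hO.mem_nhds hx)).and (hlim.eventually_lt_const hL)).exists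
  refine ⟨y K, hK1, K, fun j hj => by simp [hy, not_lt.mpr hj], ?_⟩
  have hj : ∀ j ∈ Finset.range K, ((y K).1 j : ℝ) = x.1 j := fun j hj => by
    simp [hy, Finset.mem_range.mp hj]
  rwa [Finset.sum_congr rfl hj, Finset.sum_congr rfl fun j h => by rw [hj j h]]

/-- An open set contains a uniform neighbourhood of each of its points. -/
theorem exists_uniform_nhd {O : Set DecSeq} (hO : IsOpen O) {x : DecSeq} (hx : x ∈ O) :
    ∃ η : ℝ, 0 < η ∧ ∀ y : DecSeq, (∀ j, |(y.1 j : ℝ) - x.1 j| ≤ η) → y ∈ O := by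
  by_contra! hcon
  choose! y hy hyO using fun m : ℕ => hcon (1 / ((m : ℝ) + 1)) (by positivity)
  have hlim : Tendsto y atTop (𝓝 x) := by
    rw [tendsto_subtype_rng, tendsto_pi_nhds]
    intro j
    rw [← NNReal.tendsto_coe, tendsto_iff_norm_sub_tendsto_zero]
    exact squeeze_zero (fun _ => norm_nonneg _) (fun m => hy m j) tendsto_one_div_add_atTop_nhds_zero_nat
  obtain ⟨m, hm⟩ := (hlim.eventually (hO.mem_nhds hx)).exists
  exact hyO m hm

end Energy

/-! ### Local upper bound -/

section UpperBound

variable {Ω : Type*} [MeasurableSpace Ω] {P : Measure Ω} {α c μ v γ s : ℝ} {X : ℕ → Ω → ℕ}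

theorem tailConst_pos (hc : 0 < c) (hα0 : 0 < α) {κ : ℝ} (hκ0 : 0 < κ) :
    0 < ∑' k : ℕ, c * Real.exp (-κ * (k : ℝ) ^ α) := by
  have hs : Summable fun k : ℕ => c * Real.exp (-κ * (k : ℝ) ^ α) := by
    simpa using (summable_add_pow_mul_exp_neg_rpow hα0 hκ0 0 0).mul_left c
  exact hs.tsum_pos (fun k => by positivity) 0 (by positivity)

/-- Union bound over the positions of the `K` largest variables. -/
theorem measure_exists_positions_le (hc : 0 < c) (hα0 : 0 < α) (hX : ∀ i, Measurable (X i))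
    (hindep : iIndepFun X P)
    (hlaw : ∀ i k, P {ω | X i ω = k} = ENNReal.ofReal (c * Real.exp (-(k : ℝ) ^ α)))
    {κ : ℝ} (hκ0 : 0 < κ) (hκ1 : κ < 1) {B : ℝ} (hB : 0 ≤ B) (θ w : ℝ) {n K : ℕ}
    (b : Fin K → ℝ) :
    P {ω | ∃ e : Fin K → Fin n, Function.Injective e ∧ (∀ j, b j ≤ X (e j) ω) ∧
        (∀ i : Fin n, (∀ j, e j ≠ i) → (X i ω : ℝ) ≤ B) ∧
        w ≤ θ * (∑ i ∈ Finset.range n, ((X i ω : ℝ) - μ) - ∑ j, ((X (e j) ω : ℝ) - μ))} ≤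
      ENNReal.ofReal ((n : ℝ) ^ K * (Real.exp (-w) *
        ((∏ j, (∑' k : ℕ, c * Real.exp (-κ * (k : ℝ) ^ α)) *
        Real.exp (-(1 - κ) * (max (b j) 0) ^ α)) * truncMGF α c μ B θ ^ (n - K)))) := by
  set bound := Real.exp (-w) * ((∏ j, (∑' k : ℕ, c * Real.exp (-κ * (k : ℝ) ^ α)) *
        Real.exp (-(1 - κ) * (max (b j) 0) ^ α)) * truncMGF α c μ B θ ^ (n - K)) with hbound
  have hsub : {ω | ∃ e : Fin K → Fin n, Function.Injective e ∧ (∀ j, b j ≤ X (e j) ω) ∧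
        (∀ i : Fin n, (∀ j, e j ≠ i) → (X i ω : ℝ) ≤ B) ∧
        w ≤ θ * (∑ i ∈ Finset.range n, ((X i ω : ℝ) - μ) - ∑ j, ((X (e j) ω : ℝ) - μ))} =
      ⋃ e : Fin K → Fin n, {ω | Function.Injective e ∧ (∀ j, b j ≤ X (e j) ω) ∧
        (∀ i : Fin n, (∀ j, e j ≠ i) → (X i ω : ℝ) ≤ B) ∧
        w ≤ θ * (∑ i ∈ Finset.range n, ((X i ω : ℝ) - μ) - ∑ j, ((X (e j) ω : ℝ) - μ))} := by
    ext ω; simp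
  rw [hsub]
  refine (measure_iUnion_fintype_le P _).trans ?_
  have hone : ∀ e : Fin K → Fin n, P {ω | Function.Injective e ∧ (∀ j, b j ≤ X (e j) ω) ∧
        (∀ i : Fin n, (∀ j, e j ≠ i) → (X i ω : ℝ) ≤ B) ∧
        w ≤ θ * (∑ i ∈ Finset.range n, ((X i ω : ℝ) - μ) - ∑ j, ((X (e j) ω : ℝ) - μ))} ≤
      ENNReal.ofReal bound := by
    intro e
    -- Non-injective maps give the empty event, so counting all `n ^ K` maps is harmless.
    by_cases he : Function.Injective e
    swap
    · simp [he]
    set f : Fin K → ℕ := fun j => (e j : ℕ) with hf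
    have hfinj : Function.Injective f := Fin.val_injective.comp he
    set J : Finset ℕ := Finset.univ.image f with hJ
    have hJn : J ⊆ Finset.range n := by
      intro i hi
      obtain ⟨j, -, rfl⟩ := Finset.mem_image.mp hi
      simp [hf]
    have hcard : (Finset.range n \ J).card = n - K := by
      rw [Finset.card_sdiff_of_subset hJn, hJ, Finset.card_image_of_injective _ hfinj]
      simp
    have hmain := measure_large_and_trunc_le (μ := μ) hc hα0 hX hindep hlaw hκ0 hκ1 hB θ w
      (Function.extend f b 0) (J := J) (R := Finset.range n \ J) Finset.disjoint_sdiff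
    rw [hcard, hJ, Finset.prod_image hfinj.injOn] at hmain
    simp only [hfinj.extend_apply] at hmain
    refine le_trans (measure_mono ?_) hmain
    rintro ω ⟨-, h1, h2, h3⟩
    refine ⟨?_, ?_, ?_⟩
    · intro i hi
      obtain ⟨j, -, rfl⟩ := Finset.mem_image.mp hi
      rw [hfinj.extend_apply]
      exact h1 j
    · intro i hi
      obtain ⟨hin, hiJ⟩ := Finset.mem_sdiff.mp hi
      refine h2 ⟨i, Finset.mem_range.mp hin⟩ fun j hj => hiJ ?_
      exact Finset.mem_image.mpr ⟨j, Finset.mem_univ _, by rw [hf]; simp [hj]⟩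
    · rw [Finset.sum_sdiff_eq_sub hJn, hJ, Finset.sum_image hfinj.injOn]
      exact h3
  refine (Finset.sum_le_sum fun e _ => hone e).trans ?_
  rw [Finset.sum_const, Finset.card_univ, Fintype.card_fun, Fintype.card_fin, Fintype.card_fin,
    nsmul_eq_mul, ENNReal.ofReal_mul (p := (n : ℝ) ^ K) (by positivity),
    ENNReal.ofReal_pow (by positivity)]
  simp

/-- Both conditions hold strictly at `ε = 0` and are continuous there. The same `ε` will be the
radius of the neighbourhood and the fraction of the exponent lost in `tail_le`. -/
theorem exists_slack (hα0 : 0 < α) (hα1 : α < 1) {t L : ℝ} {K : ℕ} {x : DecSeq}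
    (ht : t * (x.1 (K - 1) : ℝ) ^ (1 - α) < 1 / 2) (hL : L < minorant α v s t K x) :
    ∃ ε : ℝ, 0 < ε ∧ ε < 1 ∧ t * ((x.1 (K - 1) : ℝ) + ε) ^ (1 - α) ≤ 1 / 2 ∧
      L < (1 - ε) * ∑ j : Fin K, (max ((x.1 j : ℝ) - ε) 0) ^ α +
        (t * (s - ∑ j : Fin K, (x.1 j : ℝ)) - |t| * (K * ε)) - t ^ 2 * v / 2 := by
  have hc1 : Continuous fun ε : ℝ => t * ((x.1 (K - 1) : ℝ) + ε) ^ (1 - α) :=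
    (((continuous_const.add continuous_id).rpow_const fun _ => Or.inr (by linarith)).const_mul t)
  have hc2 : Continuous fun ε : ℝ => (1 - ε) * ∑ j : Fin K, (max ((x.1 j : ℝ) - ε) 0) ^ α +
        (t * (s - ∑ j : Fin K, (x.1 j : ℝ)) - |t| * (K * ε)) - t ^ 2 * v / 2 := by
    have : ∀ j : Fin K, Continuous fun ε : ℝ => (max ((x.1 j : ℝ) - ε) 0) ^ α := fun j =>
      ((continuous_const.sub continuous_id).max continuous_const).rpow_const fun _ => Or.inr hα0.le
    have := continuous_finsetSum Finset.univ fun j _ => this j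
    fun_prop
  have h1 : ∀ᶠ ε in 𝓝 (0 : ℝ), t * ((x.1 (K - 1) : ℝ) + ε) ^ (1 - α) < 1 / 2 :=
    hc1.continuousAt.eventually_lt_const (by simpa using ht)
  have h2 := (hc2.continuousAt (x := 0)).eventually_const_lt (u := L) (by
    have e : ∀ j : Fin K, max (x.1 j : ℝ) 0 = x.1 j := fun j => by simp
    simp only [e, sub_zero, one_mul, mul_zero]
    rw [Fin.sum_univ_eq_sum_range (fun j => (x.1 j : ℝ) ^ α),
      Fin.sum_univ_eq_sum_range (fun j => (x.1 j : ℝ))]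
    exact hL)
  have h3 : ∀ᶠ ε in 𝓝[>] (0 : ℝ), 0 < ε ∧ ε < 1 := Ioo_mem_nhdsGT one_pos
  obtain ⟨ε, ⟨h, h'⟩, ha, hb⟩ := (h3.and ((h1.filter_mono nhdsWithin_le_nhds).and
    (h2.filter_mono nhdsWithin_le_nhds))).exists
  exact ⟨ε, h, h', ha.le, hb⟩

/-- Near `x` the `K` largest variables are at least `(x_j - ε) * r`, all others are at most
`(x_{K-1} + ε) * r`, and the prescribed total determines the sum of those others up to `K * ε * r`.
The Chebyshev bound then has `minorant` as its exponent, up to the slack. -/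
theorem IsStretchedExpLaw.exists_nhd_measure_le (h : IsStretchedExpLaw α c μ v)
    (hX : ∀ i, Measurable (X i)) (hindep : iIndepFun X P)
    (hlaw : ∀ i k, P {ω | X i ω = k} = ENNReal.ofReal (c * Real.exp (-(k : ℝ) ^ α)))
    (hγ : γ = 1 / (2 - α)) {sn : ℕ → ℝ} (hsn : Tendsto sn atTop (𝓝 s)) {x : DecSeq} {L : ℝ}
    (hL0 : 0 ≤ L) (hL : ENNReal.ofReal L < energy α v s x) :
    ∃ U ∈ 𝓝 x, ∀ᶠ n : ℕ in atTop,
      P {ω | ((∑ i ∈ Finset.range n, X i ω : ℕ) : ℝ) = μ * n + sn n * (n : ℝ) ^ γ ∧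
        scaledOrderStats γ (fun i : Fin n => X i ω) ∈ U} ≤
      ENNReal.ofReal (Real.exp (-((n : ℝ) ^ (γ * α) * L))) := by
  obtain ⟨t, K, hK1, ht, hm⟩ := exists_lt_minorant h.alpha_pos h.alpha_lt_one h.var_pos hL hL0
  obtain ⟨ε, hε0, hε1, hεt, hεL⟩ := exists_slack h.alpha_pos h.alpha_lt_one ht hm
  have hα1 := h.alpha_lt_one
  set A : ℝ := ∑ j : Fin K, (max ((x.1 j : ℝ) - ε) 0) ^ α with hA
  set Sx : ℝ := ∑ j : Fin K, (x.1 j : ℝ) with hSx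
  set δ : ℝ := (x.1 (K - 1) : ℝ) + ε with hδ
  have hδ0 : 0 < δ := add_pos_of_nonneg_of_pos (x.1 (K - 1)).coe_nonneg hε0
  set C : ℝ := ∑' k : ℕ, c * Real.exp (-ε * (k : ℝ) ^ α) with hC
  have hC0 : 0 < C := tailConst_pos h.c_pos h.alpha_pos hε0
  refine ⟨{y | ∀ j ∈ Finset.range K, |(y.1 j : ℝ) - x.1 j| < ε}, ?_, ?_⟩
  · refine (Filter.eventually_all_finset (Finset.range K)).mpr fun j _ => ?_
    have : Continuous fun y : DecSeq => |(y.1 j : ℝ) - x.1 j| :=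
      ((continuous_coe_apply j).sub continuous_const).abs
    exact this.continuousAt.eventually_lt_const (by simpa using hε0)
  set Φ : ℕ → ℝ := fun n => truncMGF α c μ (δ * (n : ℝ) ^ γ) (t * ((n : ℝ) ^ γ / n)) with hΦ
  -- A lower bound for the tilted centred sum of the remaining variables; `μ * K` comes from
  -- recentring the `K` removed ones.
  set w : ℕ → ℝ := fun n => (n : ℝ) ^ γ / n * (t * (sn n * (n : ℝ) ^ γ + μ * K) -
    (n : ℝ) ^ γ * (t * Sx + |t| * (K * ε))) with hw
  have hlim : Tendsto (fun n : ℕ => K * (Real.log n / (n : ℝ) ^ (γ * α)) -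
      (t * sn n - (t * Sx + |t| * (K * ε)) + t * μ * K * (((n : ℝ) ^ γ / n) * ((n : ℝ) ^ (γ * α))⁻¹)) +
      K * Real.log C * ((n : ℝ) ^ (γ * α))⁻¹ - (1 - ε) * A +
      ((n - K : ℕ) : ℝ) / (n : ℝ) ^ (γ * α) * Real.log (Φ n)) atTop
      (𝓝 (K * 0 - (t * s - (t * Sx + |t| * (K * ε)) + t * μ * K * (0 * 0)) + K * Real.log C * 0
        - (1 - ε) * A + t ^ 2 * v / 2)) := by
    have hVi := (tendsto_speed h.alpha_pos hα1 hγ).inv_tendsto_atTop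
    exact (((((tendsto_log_div_speed h.alpha_pos hα1 hγ).const_mul _).sub
      (((hsn.const_mul t).sub_const _).add (((tendsto_scale_div hα1 hγ).mul hVi).const_mul _))).add
      (hVi.const_mul _)).sub_const _).add (h.tendsto_log_truncMGF hγ hδ0 hεt K)
  -- The limit is minus the right-hand side of `hεL`.
  have hev := hlim.eventually_lt_const (u := -L) (by nlinarith)
  filter_upwards [hev, eventually_ge_atTop K] with n hn hKn
  have hn0 : 0 < n := by omega
  have hn' : (0 : ℝ) < n := by exact_mod_cast hn0
  have hsq := scale_mul_self hα1 hγ hn0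
  have hrV := natCast_rpow_rpow (α := α) (γ := γ) n
  set r : ℝ := (n : ℝ) ^ γ with hr
  set V : ℝ := (n : ℝ) ^ (γ * α) with hV
  have hr0 : 0 < r := by positivity
  have hV0 : 0 < V := by positivity
  have hsubset : {ω | ((∑ i ∈ Finset.range n, X i ω : ℕ) : ℝ) = μ * n + sn n * r ∧
        scaledOrderStats γ (fun i : Fin n => X i ω) ∈
          {y : DecSeq | ∀ j ∈ Finset.range K, |(y.1 j : ℝ) - x.1 j| < ε}} ⊆
      {ω | ∃ e : Fin K → Fin n, Function.Injective e ∧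
        (∀ j : Fin K, ((x.1 j : ℝ) - ε) * r ≤ X (e j) ω) ∧
        (∀ i : Fin n, (∀ j, e j ≠ i) → (X i ω : ℝ) ≤ δ * r) ∧
        w n ≤ t * (r / n) *
          (∑ i ∈ Finset.range n, ((X i ω : ℝ) - μ) - ∑ j, ((X (e j) ω : ℝ) - μ))} := by
    rintro ω ⟨hsum, hU⟩
    obtain ⟨e, he, hex, hrest⟩ := exists_positions_of_largest hK1 hKn fun i : Fin n => X i ω
    have hclose : ∀ j < K, ((x.1 j : ℝ) - ε) * r ≤ revOrderStat (fun i : Fin n => X i ω) j ∧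
        (revOrderStat (fun i : Fin n => X i ω) j : ℝ) ≤ ((x.1 j : ℝ) + ε) * r := by
      intro j hj
      have := hU j (Finset.mem_range.mpr hj)
      rw [coe_scaledOrderStats, ← hr, abs_lt] at this
      constructor
      · rw [← le_div_iff₀ hr0]; linarith
      · rw [← div_le_iff₀ hr0]; linarith
    refine ⟨e, he, fun j => ?_, fun i hi => ?_, ?_⟩
    · have := (hclose j j.2).1
      rwa [← hex j] at this
    · have h1 := hrest i hi
      have h2 : (X i ω : ℝ) ≤ revOrderStat (fun i : Fin n => X i ω) (K - 1) := by exact_mod_cast h1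
      exact h2.trans (hclose (K - 1) (by omega)).2
    · have hS1 : ∑ i ∈ Finset.range n, ((X i ω : ℝ) - μ) = sn n * r := by
        rw [Finset.sum_sub_distrib, ← Nat.cast_sum, hsum]
        simp; ring
      have hS2 : |∑ j, ((X (e j) ω : ℝ)) - r * Sx| ≤ r * (K * ε) := by
        rw [hSx, Finset.mul_sum, ← Finset.sum_sub_distrib]
        refine (Finset.abs_sum_le_sum_abs _ _).trans ?_
        calc ∑ j : Fin K, |(X (e j) ω : ℝ) - r * x.1 j| ≤ ∑ _j : Fin K, r * ε := by
              refine Finset.sum_le_sum fun j _ => ?_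
              have h3 := hclose j j.2
              rw [← hex j] at h3
              rw [abs_le]
              constructor <;> nlinarith [h3.1, h3.2]
          _ = r * (K * ε) := by simp; ring
      have hS3 : t * (∑ j, ((X (e j) ω : ℝ)) - r * Sx) ≤ |t| * (r * (K * ε)) :=
        (le_abs_self _).trans (by rw [abs_mul]; gcongr)
      rw [hS1, Finset.sum_sub_distrib]
      simp only [Finset.sum_const, Finset.card_univ, Fintype.card_fin, nsmul_eq_mul]
      have hrn : 0 ≤ r / n := by positivity
      have : t * (sn n * r + μ * K) - r * (t * Sx + |t| * (K * ε)) ≤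
          t * (sn n * r - (∑ j, ((X (e j) ω : ℝ)) - K * μ)) := by linarith
      calc w n = r / n * (t * (sn n * r + μ * K) - r * (t * Sx + |t| * (K * ε))) := rfl
        _ ≤ r / n * (t * (sn n * r - (∑ j, ((X (e j) ω : ℝ)) - K * μ))) :=
            mul_le_mul_of_nonneg_left this hrn
        _ = _ := by ring
  refine (measure_mono hsubset).trans ((measure_exists_positions_le h.c_pos h.alpha_pos hX hindep hlaw
    hε0 hε1 (mul_pos hδ0 hr0).le _ _ _).trans (ENNReal.ofReal_le_ofReal ?_))
  have hpos : 0 < Φ n := truncMGF_pos h.c_pos (by positivity) _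
  have hprod : ∏ j : Fin K, C * Real.exp (-(1 - ε) * (max (((x.1 j : ℝ) - ε) * r) 0) ^ α) =
      Real.exp (K * Real.log C - (1 - ε) * A * V) := by
    rw [Finset.prod_mul_distrib, ← Real.exp_sum, Finset.prod_const, Finset.card_univ,
      Fintype.card_fin, sub_eq_add_neg (K * Real.log C), Real.exp_add]
    congr 1
    · rw [mul_comm, Real.exp_mul, Real.exp_log hC0, Real.rpow_natCast]
    · congr 1
      rw [← Finset.mul_sum, hA, neg_mul, mul_assoc, Finset.sum_mul]
      congr 2
      refine Finset.sum_congr rfl fun j _ => ?_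
      rw [← hrV, ← Real.mul_rpow (le_max_right _ _) hr0.le, max_mul_of_nonneg _ _ hr0.le, zero_mul]
  have hΦpow : Φ n ^ (n - K) = Real.exp (((n - K : ℕ) : ℝ) * Real.log (Φ n)) := by
    rw [mul_comm, Real.exp_mul, Real.exp_log hpos, Real.rpow_natCast]
  have hnK : (n : ℝ) ^ K = Real.exp (K * Real.log n) := by
    rw [mul_comm, Real.exp_mul, Real.exp_log hn', Real.rpow_natCast]
  change (n : ℝ) ^ K * (Real.exp (-w n) *
    ((∏ j : Fin K, C * Real.exp (-(1 - ε) * (max (((x.1 j : ℝ) - ε) * r) 0) ^ α)) * Φ n ^ (n - K))) ≤ _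
  rw [hprod, hΦpow, hnK, ← Real.exp_add, ← Real.exp_add, ← Real.exp_add]
  apply Real.exp_le_exp.mpr
  have hwV : w n = V * (t * sn n - (t * Sx + |t| * (K * ε)) + t * μ * K * ((r / n) * V⁻¹)) := by
    have : V = r * r / n := by rw [hsq]; field_simp
    change r / n * (t * (sn n * r + μ * K) - r * (t * Sx + |t| * (K * ε))) = _
    rw [this]; field_simp; ring
  have hn2 := mul_lt_mul_of_pos_left hn hV0
  rw [hwV]
  have e1 : V * (K * (Real.log n / V)) = K * Real.log n := by field_simp
  have e2 : V * (K * Real.log C * V⁻¹) = K * Real.log C := by field_simp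
  have e3 : V * (((n - K : ℕ) : ℝ) / V * Real.log (Φ n)) = ((n - K : ℕ) : ℝ) * Real.log (Φ n) := by
    field_simp
  linarith [e1, e2, e3, hn2]

end UpperBound

/-! ### Exponential tightness and closed sets -/

section UpperBound

variable {Ω : Type*} [MeasurableSpace Ω] {P : Measure Ω} {α c μ v γ s : ℝ} {X : ℕ → Ω → ℕ}

/-- Exponential tightness of the largest order statistic. -/
theorem exists_measure_largest_le (hc : 0 < c) (hα0 : 0 < α) (hα1 : α < 1)
    (hX : ∀ i, Measurable (X i))
    (hlaw : ∀ i k, P {ω | X i ω = k} = ENNReal.ofReal (c * Real.exp (-(k : ℝ) ^ α)))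
    (hγ : γ = 1 / (2 - α)) {L : ℝ} (hL : 0 ≤ L) :
    ∃ M : ℝ≥0, ∀ᶠ n : ℕ in atTop,
      P {ω | ¬ (scaledOrderStats γ (fun i : Fin n => X i ω)).1 0 ≤ M} ≤
        ENNReal.ofReal (Real.exp (-((n : ℝ) ^ (γ * α) * L))) := by
  -- The factor `2` compensates `κ = 1 / 2` in `tail_le`; the extra `1` in the rate pays for the
  -- union bound over `n` variables and for the constant `C`.
  set M : ℝ≥0 := (2 * (L.toNNReal + 1)) ^ α⁻¹ with hM
  have hMα : (M : ℝ) ^ α = 2 * (L + 1) := by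
    rw [hM, NNReal.coe_rpow, ← Real.rpow_mul (by positivity), inv_mul_cancel₀ hα0.ne', Real.rpow_one]
    simp [hL]
  set C : ℝ := ∑' k : ℕ, c * Real.exp (-(1 / 2) * (k : ℝ) ^ α) with hC
  have hC0 : 0 < C := tailConst_pos hc hα0 (by norm_num)
  refine ⟨M, ?_⟩
  have hlim : Tendsto (fun n : ℕ => Real.log n / (n : ℝ) ^ (γ * α) +
      Real.log C * ((n : ℝ) ^ (γ * α))⁻¹) atTop (𝓝 (0 + Real.log C * 0)) :=
    (tendsto_log_div_speed hα0 hα1 hγ).add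
      ((tendsto_speed hα0 hα1 hγ).inv_tendsto_atTop.const_mul _)
  filter_upwards [hlim.eventually_le_const (u := 1) (by norm_num), eventually_gt_atTop 0] with n hn hn0
  have hn' : (0 : ℝ) < n := by exact_mod_cast hn0
  have hrV := natCast_rpow_rpow (α := α) (γ := γ) n
  set r : ℝ := (n : ℝ) ^ γ with hr
  set V : ℝ := (n : ℝ) ^ (γ * α) with hV
  have hr0 : 0 < r := by positivity
  have hV0 : 0 < V := by positivity
  have hXr : ∀ i, Measurable fun ω => (X i ω : ℝ) := fun i =>
    (measurable_of_countable (fun k : ℕ => (k : ℝ))).comp (hX i)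
  have hsub : {ω | ¬ (scaledOrderStats γ (fun i : Fin n => X i ω)).1 0 ≤ M} ⊆
      ⋃ i : Fin n, {ω | M * r ≤ (X i ω : ℝ)} := by
    intro ω hω
    obtain ⟨ρ, hρ⟩ := exists_perm_revOrderStat fun i : Fin n => X i ω
    have h1 : (M : ℝ) < ((scaledOrderStats γ (fun i : Fin n => X i ω)).1 0 : ℝ) := by
      exact_mod_cast not_le.mp hω
    rw [coe_scaledOrderStats, ← hr, lt_div_iff₀ hr0] at h1
    have h2 := hρ ⟨0, hn0⟩
    refine Set.mem_iUnion.mpr ⟨ρ ⟨0, hn0⟩, ?_⟩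
    simp only [Set.mem_ofPred_eq]
    rw [h2]
    exact h1.le
  refine (measure_mono hsub).trans ((measure_iUnion_fintype_le P _).trans ?_)
  have hone : ∀ i : Fin n, P {ω | M * r ≤ (X i ω : ℝ)} ≤ ENNReal.ofReal (C * Real.exp (-(V * (L + 1)))) := by
    intro i
    have hmeas : MeasurableSet {ω | M * r ≤ (X i ω : ℝ)} := measurableSet_le measurable_const (hXr i)
    have := tail_le hc hα0 hX hlaw (κ := 1 / 2) (by norm_num) (by norm_num) (M * r) i
    rw [← lintegral_indicator_one hmeas]
    refine le_trans (lintegral_mono fun ω => ?_) (this.trans (le_of_eq ?_))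
    · refine Set.indicator_apply_le' (fun hω => ?_) fun _ => zero_le
      rw [if_pos (show M * r ≤ (X i ω : ℝ) from hω)]; exact le_rfl
    · rw [max_eq_left (by positivity), Real.mul_rpow M.coe_nonneg hr0.le, hMα, hrV]
      congr 3
      ring
  refine (Finset.sum_le_sum fun i _ => hone i).trans ?_
  rw [Finset.sum_const, Finset.card_univ, Fintype.card_fin, nsmul_eq_mul,
    ← ENNReal.ofReal_natCast, ← ENNReal.ofReal_mul (by positivity)]
  apply ENNReal.ofReal_le_ofReal
  have e0 : n * (C * Real.exp (-(V * (L + 1)))) =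
      Real.exp (Real.log n + (Real.log C + -(V * (L + 1)))) := by
    rw [Real.exp_add, Real.exp_add, Real.exp_log hn', Real.exp_log hC0]
  rw [e0]
  apply Real.exp_le_exp.mpr
  have h1 := mul_le_mul_of_nonneg_left hn hV0.le
  have e : V * (Real.log n / V + Real.log C * V⁻¹) = Real.log n + Real.log C := by field_simp
  linarith

/-- Cover the compact part of `A` by finitely many of the local neighbourhoods and discard the event
of a large maximum. The loss `ε` serves only to absorb the number of pieces. -/
theorem IsStretchedExpLaw.measure_closed_le (h : IsStretchedExpLaw α c μ v)
    (hX : ∀ i, Measurable (X i)) (hindep : iIndepFun X P)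
    (hlaw : ∀ i k, P {ω | X i ω = k} = ENNReal.ofReal (c * Real.exp (-(k : ℝ) ^ α)))
    (hγ : γ = 1 / (2 - α)) {sn : ℕ → ℝ} (hsn : Tendsto sn atTop (𝓝 s)) {A : Set DecSeq}
    (hA : IsClosed A) {L ε : ℝ} (hL0 : 0 ≤ L) (hL : ∀ x ∈ A, ENNReal.ofReal L < energy α v s x)
    (hε : 0 < ε) :
    ∀ᶠ n : ℕ in atTop,
      P {ω | ((∑ i ∈ Finset.range n, X i ω : ℕ) : ℝ) = μ * n + sn n * (n : ℝ) ^ γ ∧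
        scaledOrderStats γ (fun i : Fin n => X i ω) ∈ A} ≤
      ENNReal.ofReal (Real.exp (-((n : ℝ) ^ (γ * α) * (L - ε)))) := by
  have hα1 := h.alpha_lt_one
  obtain ⟨M, hM⟩ := exists_measure_largest_le h.c_pos h.alpha_pos hα1 hX hlaw hγ hL0
  have hcpt : IsCompact (A ∩ {x : DecSeq | x.1 0 ≤ M}) := (isCompact_apply_zero_le M).inter_left hA
  have hcover : ∃ m : ℕ, ∀ᶠ n : ℕ in atTop,
      P {ω | ((∑ i ∈ Finset.range n, X i ω : ℕ) : ℝ) = μ * n + sn n * (n : ℝ) ^ γ ∧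
        scaledOrderStats γ (fun i : Fin n => X i ω) ∈ A ∩ {x : DecSeq | x.1 0 ≤ M}} ≤
      m * ENNReal.ofReal (Real.exp (-((n : ℝ) ^ (γ * α) * L))) := by
    refine hcpt.induction_on (p := fun S => ∃ m : ℕ, ∀ᶠ n : ℕ in atTop,
      P {ω | ((∑ i ∈ Finset.range n, X i ω : ℕ) : ℝ) = μ * n + sn n * (n : ℝ) ^ γ ∧
        scaledOrderStats γ (fun i : Fin n => X i ω) ∈ S} ≤
      m * ENNReal.ofReal (Real.exp (-((n : ℝ) ^ (γ * α) * L)))) ?_ ?_ ?_ ?_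
    · exact ⟨0, Eventually.of_forall fun n => by simp⟩
    · rintro S T hST ⟨m, hm⟩
      refine ⟨m, hm.mono fun n hn => (measure_mono ?_).trans hn⟩
      exact fun ω hω => ⟨hω.1, hST hω.2⟩
    · rintro S T ⟨m, hm⟩ ⟨m', hm'⟩
      refine ⟨m + m', ?_⟩
      filter_upwards [hm, hm'] with n hn hn'
      rw [Nat.cast_add, add_mul]
      refine le_trans (measure_mono ?_) ((measure_union_le _ _).trans (add_le_add hn hn'))
      rintro ω ⟨h1, h2 | h2⟩
      · exact Or.inl ⟨h1, h2⟩
      · exact Or.inr ⟨h1, h2⟩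
    · intro x hx
      obtain ⟨U, hU, hUn⟩ := h.exists_nhd_measure_le hX hindep hlaw hγ hsn hL0 (hL x hx.1)
      exact ⟨U, nhdsWithin_le_nhds hU, 1, by simpa using hUn⟩
  obtain ⟨m, hm⟩ := hcover
  have hbig : ∀ᶠ n : ℕ in atTop, (m : ℝ) + 1 ≤ Real.exp ((n : ℝ) ^ (γ * α) * ε) :=
    (Real.tendsto_exp_atTop.comp
      ((tendsto_speed h.alpha_pos hα1 hγ).atTop_mul_const hε)).eventually_ge_atTop _
  filter_upwards [hM, hm, hbig] with n h1 h2 h3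
  calc P {ω | ((∑ i ∈ Finset.range n, X i ω : ℕ) : ℝ) = μ * n + sn n * (n : ℝ) ^ γ ∧
        scaledOrderStats γ (fun i : Fin n => X i ω) ∈ A}
      ≤ m * ENNReal.ofReal (Real.exp (-((n : ℝ) ^ (γ * α) * L))) +
          ENNReal.ofReal (Real.exp (-((n : ℝ) ^ (γ * α) * L))) := by
        refine le_trans (measure_mono ?_) ((measure_union_le _ _).trans (add_le_add h2 h1))
        rintro ω ⟨ha, hb⟩
        by_cases hc : (scaledOrderStats γ (fun i : Fin n => X i ω)).1 0 ≤ M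
        · exact Or.inl ⟨ha, hb, hc⟩
        · exact Or.inr hc
    _ = ENNReal.ofReal ((m + 1) * Real.exp (-((n : ℝ) ^ (γ * α) * L))) := by
        rw [ENNReal.ofReal_mul (by positivity), ENNReal.ofReal_add (by positivity) zero_le_one,
          ENNReal.ofReal_natCast, ENNReal.ofReal_one, add_mul, one_mul]
    _ ≤ ENNReal.ofReal (Real.exp ((n : ℝ) ^ (γ * α) * ε) * Real.exp (-((n : ℝ) ^ (γ * α) * L))) := by
        gcongr
    _ = _ := by rw [← Real.exp_add]; congr 2; ring

end UpperBound

/-! ### Moderate deviations of the bulk and exact hitting of the total -/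

section LowerBound

variable {Ω : Type*} [MeasurableSpace Ω] {P : Measure Ω} {α c μ v γ s : ℝ} {X : ℕ → Ω → ℕ}

theorem truncMGF_pow_eq_exp (hc : 0 < c) {B V : ℝ} (hB : 0 ≤ B) (hV : 0 < V) (θ : ℝ) (m : ℕ) :
    truncMGF α c μ B θ ^ m = Real.exp (V * (m / V * Real.log (truncMGF α c μ B θ))) := by
  have hpos : 0 < truncMGF α c μ B θ := truncMGF_pos hc hB θ
  have : V * (m / V * Real.log (truncMGF α c μ B θ)) = Real.log (truncMGF α c μ B θ) * m := by
    field_simp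
  rw [this, Real.exp_mul, Real.exp_log hpos, Real.rpow_natCast]

/-- Moderate deviation lower bound for the centred sum of variables truncated at `η n ^ γ`. -/
theorem IsStretchedExpLaw.measure_window_ge [IsProbabilityMeasure P] (h : IsStretchedExpLaw α c μ v)
    (hX : ∀ i, Measurable (X i)) (hindep : iIndepFun X P)
    (hlaw : ∀ i k, P {ω | X i ω = k} = ENNReal.ofReal (c * Real.exp (-(k : ℝ) ^ α)))
    (hγ : γ = 1 / (2 - α)) {u ζ η ε : ℝ} (hζ : 0 < ζ) (hη : 0 < η)
    (hηu : (|u| / v + ζ / v) * η ^ (1 - α) ≤ 1 / 2) (K : ℕ) (hε : 0 < ε) :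
    ∀ᶠ n : ℕ in atTop,
      Real.exp (-((n : ℝ) ^ (γ * α) * (u ^ 2 / (2 * v) + |u| / v * ζ + ε))) ≤
      P.real {ω | (∀ i ∈ Finset.Ico K n, (X i ω : ℝ) ≤ η * (n : ℝ) ^ γ) ∧
        (u - ζ) * (n : ℝ) ^ γ ≤ ∑ i ∈ Finset.Ico K n, ((X i ω : ℝ) - μ) ∧
        ∑ i ∈ Finset.Ico K n, ((X i ω : ℝ) - μ) ≤ (u + ζ) * (n : ℝ) ^ γ} := by
  have hα1 := h.alpha_lt_one
  have hv := h.var_pos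
  -- The tilt `t` moves the mean of the bulk to `u * r` at leading order. The further tilts `± κ`
  -- with `κ = ζ / v` are the optimal ones for leaving a window of half-width `ζ`.
  set t := u / v with ht
  set κ := ζ / v with hκ
  have hκ0 : 0 < κ := by positivity
  have habs : |t| = |u| / v := by rw [ht, abs_div, abs_of_pos hv]
  have hηα : 0 ≤ η ^ (1 - α) := by positivity
  have hu : u = t * v := by rw [ht]; field_simp
  have hζv : ζ = κ * v := by rw [hκ]; field_simp
  have hbd : ∀ a : ℝ, a ≤ |t| + κ → a * η ^ (1 - α) ≤ 1 / 2 := fun a ha => by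
    rw [← habs] at hηu
    exact (mul_le_mul_of_nonneg_right ha hηα).trans hηu
  have hl0 := h.tendsto_log_truncMGF hγ hη (hbd t (by linarith [le_abs_self t])) K
  have hl1 := h.tendsto_log_truncMGF hγ hη (hbd (t + κ) (by linarith [le_abs_self t])) K
  have hl2 := h.tendsto_log_truncMGF hγ hη (hbd (t - κ) (by linarith [le_abs_self t])) K
  -- The rate gained on each side: `(t ± κ) ^ 2 * v / 2 ∓ κ * (u ± ζ) = t ^ 2 * v / 2 - D`. Hence
  -- the tilted mass outside the window is exponentially negligible.
  set D := κ ^ 2 * v / 2 with hD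
  have hD0 : 0 < D := by positivity
  set ε' := min (ε / 2) (D / 4) with hε'
  have hε'0 : 0 < ε' := by positivity
  have hε'1 : ε' ≤ ε / 2 := min_le_left _ _
  have hε'2 : ε' ≤ D / 4 := min_le_right _ _
  have hV := tendsto_speed h.alpha_pos hα1 hγ
  have hbig1 : ∀ᶠ n : ℕ in atTop, 4 ≤ Real.exp ((n : ℝ) ^ (γ * α) * (D / 2)) :=
    (Real.tendsto_exp_atTop.comp (hV.atTop_mul_const (by positivity))).eventually_ge_atTop _
  have hbig2 : ∀ᶠ n : ℕ in atTop, 2 ≤ Real.exp ((n : ℝ) ^ (γ * α) * (ε / 2)) :=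
    (Real.tendsto_exp_atTop.comp (hV.atTop_mul_const (by positivity))).eventually_ge_atTop _
  filter_upwards [hl0.eventually_const_lt (u := t ^ 2 * v / 2 - ε') (by linarith),
    hl1.eventually_lt_const (u := (t + κ) ^ 2 * v / 2 + ε') (by linarith),
    hl2.eventually_lt_const (u := (t - κ) ^ 2 * v / 2 + ε') (by linarith), hbig1, hbig2,
    eventually_gt_atTop 0] with n h0 h1 h2 hb1 hb2 hn0
  have hn' : (0 : ℝ) < n := by exact_mod_cast hn0
  have hsq := scale_mul_self hα1 hγ hn0
  set r : ℝ := (n : ℝ) ^ γ with hr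
  set V : ℝ := (n : ℝ) ^ (γ * α) with hVdef
  have hr0 : 0 < r := by positivity
  have hV0 : 0 < V := by positivity
  have hVe : r * (r / n) = V := by rw [← mul_div_assoc, hsq]; field_simp
  have hB : 0 ≤ η * r := by positivity
  have key := truncMGF_pow_le (P := P) (μ := μ) h.c_pos hX hindep hlaw hB
    (θ := t * (r / n)) (τ := κ * (r / n)) (w := V * (t * u + |t| * ζ))
    (a := (u - ζ) * r) (b := (u + ζ) * r) (by positivity) (by
      intro z hz1 hz2
      have hd : |z - u * r| ≤ ζ * r := by rw [abs_le]; constructor <;> linarith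
      have h3 : t * (z - u * r) ≤ |t| * (ζ * r) :=
        (le_abs_self _).trans (by rw [abs_mul]; gcongr)
      have h4 : t * z ≤ r * (t * u + |t| * ζ) := by linarith
      calc t * (r / n) * z = r / n * (t * z) := by ring
        _ ≤ r / n * (r * (t * u + |t| * ζ)) := by gcongr
        _ = V * (t * u + |t| * ζ) := by rw [← hVe]; ring) (Finset.Ico K n)
  rw [Nat.card_Ico, truncMGF_pow_eq_exp h.c_pos hB hV0, truncMGF_pow_eq_exp h.c_pos hB hV0,
    truncMGF_pow_eq_exp h.c_pos hB hV0, ← add_mul, ← sub_mul, ← Real.exp_add, ← Real.exp_add] at key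
  set p := P.real {ω | (∀ i ∈ Finset.Ico K n, (X i ω : ℝ) ≤ η * r) ∧
        (u - ζ) * r ≤ ∑ i ∈ Finset.Ico K n, ((X i ω : ℝ) - μ) ∧
        ∑ i ∈ Finset.Ico K n, ((X i ω : ℝ) - μ) ≤ (u + ζ) * r} with hp
  set Y := Real.exp (V * (t ^ 2 * v / 2 - ε')) with hY
  have hY0 : 0 < Y := Real.exp_pos _
  have k0 : Y ≤ Real.exp (V * (((n - K : ℕ) : ℝ) / V *
      Real.log (truncMGF α c μ (η * r) (t * (r / n))))) :=
    Real.exp_le_exp.mpr (mul_le_mul_of_nonneg_left h0.le hV0.le)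
  have hsmall : Real.exp (V * (t ^ 2 * v / 2 - D + ε')) ≤ Y / 4 := by
    rw [le_div_iff₀ (by norm_num)]
    calc Real.exp (V * (t ^ 2 * v / 2 - D + ε')) * 4
        ≤ Real.exp (V * (t ^ 2 * v / 2 - D + ε')) * Real.exp (V * (D / 2)) := by gcongr
      _ = Real.exp (V * (t ^ 2 * v / 2 - D / 2 + ε')) := by rw [← Real.exp_add]; congr 1; ring
      _ ≤ Y := by
        apply Real.exp_le_exp.mpr
        apply mul_le_mul_of_nonneg_left _ hV0.le
        linarith
  have k1 : Real.exp (-(κ * (r / n) * ((u + ζ) * r)) + V * (((n - K : ℕ) : ℝ) / V *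
      Real.log (truncMGF α c μ (η * r) ((t + κ) * (r / n))))) ≤ Y / 4 := by
    refine le_trans (Real.exp_le_exp.mpr ?_) hsmall
    have e : κ * (r / n) * ((u + ζ) * r) = V * (κ * (u + ζ)) := by rw [← hVe]; ring
    have := mul_le_mul_of_nonneg_left h1.le hV0.le
    have e2 : (t + κ) ^ 2 * v / 2 + ε' - κ * (u + ζ) = t ^ 2 * v / 2 - D + ε' := by
      rw [hu, hζv, hD]; ring
    rw [e, ← e2]
    linarith
  have k2 : Real.exp (κ * (r / n) * ((u - ζ) * r) + V * (((n - K : ℕ) : ℝ) / V *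
      Real.log (truncMGF α c μ (η * r) ((t - κ) * (r / n))))) ≤ Y / 4 := by
    refine le_trans (Real.exp_le_exp.mpr ?_) hsmall
    have e : κ * (r / n) * ((u - ζ) * r) = V * (κ * (u - ζ)) := by rw [← hVe]; ring
    have := mul_le_mul_of_nonneg_left h2.le hV0.le
    have e2 : (t - κ) ^ 2 * v / 2 + ε' + κ * (u - ζ) = t ^ 2 * v / 2 - D + ε' := by
      rw [hu, hζv, hD]; ring
    rw [e, ← e2]
    linarith
  -- The two sides take at most `Y / 4` each of a total of at least `Y`.
  have hmain : Y / 2 ≤ Real.exp (V * (t * u + |t| * ζ)) * p := by linarith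
  have hfin : Real.exp (-(V * (u ^ 2 / (2 * v) + |t| * ζ + ε))) * Real.exp (V * (t * u + |t| * ζ)) ≤
      Y / 2 := by
    rw [le_div_iff₀ (by norm_num), ← Real.exp_add]
    calc _ ≤ Real.exp (-(V * (u ^ 2 / (2 * v) + |t| * ζ + ε)) + V * (t * u + |t| * ζ)) *
          Real.exp (V * (ε / 2)) := by gcongr
      _ = Real.exp (V * (t ^ 2 * v / 2 - ε / 2)) := by
        rw [← Real.exp_add]; congr 1; rw [hu]; field_simp; ring
      _ ≤ Y := Real.exp_le_exp.mpr (mul_le_mul_of_nonneg_left (by linarith) hV0.le)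
  rw [← habs]
  have := hfin.trans hmain
  rw [mul_comm (Real.exp (V * (t * u + |t| * ζ)))] at this
  exact le_of_mul_le_mul_right this (Real.exp_pos _)

theorem measure_block_eq (hX : ∀ i, Measurable (X i)) (hindep : iIndepFun X P)
    (hlaw : ∀ i k, P {ω | X i ω = k} = ENNReal.ofReal (c * Real.exp (-(k : ℝ) ^ α)))
    {S R : Finset ℕ} (hSR : Disjoint S R) (k : ℕ → ℕ) (W : Set (R → ℕ)) :
    P ({ω | ∀ i ∈ S, X i ω = k i} ∩ {ω | (fun i : R => X i ω) ∈ W}) =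
      (∏ i ∈ S, ENNReal.ofReal (c * Real.exp (-(k i : ℝ) ^ α))) * P {ω | (fun i : R => X i ω) ∈ W} := by
  have hind := hindep.indepFun_finset S R hSR hX
  have h1 := hind.measure_inter_preimage_eq_mul {x : S → ℕ | ∀ i, x i = k i} W
    (Set.to_countable _).measurableSet (Set.to_countable _).measurableSet
  have e1 : (fun ω (i : S) => X i ω) ⁻¹' {x : S → ℕ | ∀ i, x i = k i} = {ω | ∀ i ∈ S, X i ω = k i} := by
    ext ω; simp
  rw [e1] at h1
  refine h1.trans ?_
  congr 1
  have h2 := hindep.measure_inter_preimage_eq_mul S (sets := fun i => {k i})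
    fun i _ => measurableSet_singleton _
  have e2 : ⋂ i ∈ S, X i ⁻¹' {k i} = {ω | ∀ i ∈ S, X i ω = k i} := by ext ω; simp
  rw [e2] at h2
  rw [h2]
  exact Finset.prod_congr rfl fun i _ => hlaw i (k i)

/-- One extra variable, of size at most `D`, is used to hit the prescribed total `N` exactly. -/
theorem measure_prescribed_sum_ge (hc : 0 < c) (hα0 : 0 < α) (hX : ∀ i, Measurable (X i))
    (hindep : iIndepFun X P)
    (hlaw : ∀ i k, P {ω | X i ω = k} = ENNReal.ofReal (c * Real.exp (-(k : ℝ) ^ α)))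
    {K n D N : ℕ} (hKn : K < n) {R : Finset ℕ} (hR : R = Finset.Ico (K + 1) n) (k : ℕ → ℕ)
    (W : Set (R → ℕ))
    (hW : ∀ x ∈ W, ∃ d ≤ D, ∑ i ∈ Finset.range K, k i + d + ∑ i, x i = N) :
    (∏ i ∈ Finset.range K, ENNReal.ofReal (c * Real.exp (-(k i : ℝ) ^ α))) *
        ENNReal.ofReal (c * Real.exp (-(D : ℝ) ^ α)) *
        P {ω | (fun i : R => X i ω) ∈ W} ≤
      P {ω | (∀ i ∈ Finset.range K, X i ω = k i) ∧ X K ω ≤ D ∧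
        (fun i : R => X i ω) ∈ W ∧ ∑ i ∈ Finset.range n, X i ω = N} := by
  set Wd : ℕ → Set (R → ℕ) := fun d => {x ∈ W | ∑ i ∈ Finset.range K, k i + d + ∑ i, x i = N} with hWd
  set kd : ℕ → ℕ → ℕ := fun d => Function.update k K d with hkd
  set H : ℕ → Set Ω := fun d => {ω | ∀ i ∈ Finset.range (K + 1), X i ω = kd d i} with hH
  have hdisjSR : Disjoint (Finset.range (K + 1)) R := by
    rw [Finset.disjoint_left]; intro i hi hi'
    simp only [hR, Finset.mem_Ico, Finset.mem_range] at hi hi'; omega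
  have hXR : Measurable fun ω (i : R) => X i ω := measurable_pi_lambda _ fun i => hX i
  have hprod : ∀ d ≤ D, (∏ i ∈ Finset.range K, ENNReal.ofReal (c * Real.exp (-(k i : ℝ) ^ α))) *
        ENNReal.ofReal (c * Real.exp (-(D : ℝ) ^ α)) ≤
      ∏ i ∈ Finset.range (K + 1), ENNReal.ofReal (c * Real.exp (-(kd d i : ℝ) ^ α)) := by
    intro d hd
    rw [Finset.prod_range_succ]
    refine mul_le_mul' (le_of_eq (Finset.prod_congr rfl fun i hi => ?_)) ?_
    · rw [hkd]
      have : i ≠ K := (Finset.mem_range.mp hi).ne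
      simp [Function.update_of_ne this]
    · simp only [hkd, Function.update_self]
      gcongr
  have hHX : ∀ d, ∀ ω ∈ H d, X K ω = d ∧ ∀ i ∈ Finset.range K, X i ω = k i := by
    intro d ω hω
    constructor
    · simpa [hkd] using hω K (by simp)
    · intro i hi
      have h1 := hω i (by simp at hi ⊢; omega)
      have : i ≠ K := (Finset.mem_range.mp hi).ne
      simpa [hkd, Function.update_of_ne this] using h1
  -- Split `W` according to the missing amount `d`, whose atom weighs at least as much as that of
  -- `D`. The pieces recombine without loss, since different `d` mean different values of `X K`.
  calc _ ≤ (∏ i ∈ Finset.range K, ENNReal.ofReal (c * Real.exp (-(k i : ℝ) ^ α))) *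
        ENNReal.ofReal (c * Real.exp (-(D : ℝ) ^ α)) *
        ∑ d ∈ Finset.range (D + 1), P {ω | (fun i : R => X i ω) ∈ Wd d} := by
        gcongr
        refine le_trans (measure_mono ?_) (measure_biUnion_finset_le _ _)
        intro ω hω
        obtain ⟨d, hd, hsum⟩ := hW _ hω
        simp only [Set.mem_iUnion]
        exact ⟨d, Finset.mem_range.mpr (by omega), hω, hsum⟩
    _ ≤ ∑ d ∈ Finset.range (D + 1), P (H d ∩ {ω | (fun i : R => X i ω) ∈ Wd d}) := by
        rw [Finset.mul_sum]
        refine Finset.sum_le_sum fun d hd => ?_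
        rw [hH, measure_block_eq hX hindep hlaw hdisjSR (kd d) (Wd d)]
        gcongr
        exact hprod d (by simp at hd; omega)
    _ = P (⋃ d ∈ Finset.range (D + 1), H d ∩ {ω | (fun i : R => X i ω) ∈ Wd d}) := by
        rw [measure_biUnion_finset]
        · intro d _ d' _ hdd'
          refine Set.disjoint_left.mpr fun ω h1 h2 => hdd' ?_
          rw [← (hHX d ω h1.1).1, (hHX d' ω h2.1).1]
        · intro d _
          refine (measurableSet_forall_mem _ fun i => ?_).inter
            (hXR (Set.to_countable (Wd d)).measurableSet)
          exact hX i (measurableSet_singleton _)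
    _ ≤ _ := by
        refine measure_mono ?_
        intro ω hω
        simp only [Set.mem_iUnion] at hω
        obtain ⟨d, hd, hω1, hω2⟩ := hω
        obtain ⟨h1, h2⟩ := hHX d ω hω1
        refine ⟨h2, ?_, hω2.1, ?_⟩
        · rw [h1]; simp at hd; omega
        · have h3 := hω2.2
          rw [Finset.range_eq_Ico, ← Finset.sum_Ico_consecutive _ (Nat.zero_le (K + 1)) (by omega : K + 1 ≤ n),
            ← Finset.range_eq_Ico, Finset.sum_range_succ, h1, Finset.sum_congr rfl h2]
          rw [← h3]
          congr 1
          rw [← hR]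
          exact (Finset.sum_coe_sort R fun i => X i ω).symm

end LowerBound

/-! ### Lower bound for open sets -/

section LowerBound

variable {Ω : Type*} [MeasurableSpace Ω] {P : Measure Ω} {α c μ v γ s : ℝ} {X : ℕ → Ω → ℕ}

theorem exists_window_width (hα0 : 0 < α) {T A L η₀ : ℝ} (hη₀ : 0 < η₀)
    (hL : A + T ^ 2 / (2 * v) < L) :
    ∃ ζ : ℝ, 0 < ζ ∧ 4 * ζ ≤ η₀ ∧
      A + (4 * ζ) ^ α + ((T - 2 * ζ) ^ 2 / (2 * v) + |T - 2 * ζ| / v * ζ) < L := by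
  have hc : Continuous fun ζ : ℝ =>
      A + (4 * ζ) ^ α + ((T - 2 * ζ) ^ 2 / (2 * v) + |T - 2 * ζ| / v * ζ) := by
    have : Continuous fun ζ : ℝ => (4 * ζ) ^ α :=
      (continuous_const.mul continuous_id).rpow_const fun _ => Or.inr hα0.le
    fun_prop
  have h1 := (hc.continuousAt (x := 0)).eventually_lt_const (u := L) (by
    simpa [Real.zero_rpow hα0.ne'] using hL)
  have h2 : ∀ᶠ ζ in 𝓝[>] (0 : ℝ), 0 < ζ ∧ ζ < η₀ / 4 := Ioo_mem_nhdsGT (by positivity)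
  obtain ⟨ζ, ⟨h, h'⟩, hb⟩ := (h2.and (h1.filter_mono nhdsWithin_le_nhds)).exists
  exact ⟨ζ, h, by linarith, hb⟩

theorem exists_truncation_level (hα1 : α < 1) (a : ℝ) {η₀ : ℝ} (hη₀ : 0 < η₀) :
    ∃ η : ℝ, 0 < η ∧ η ≤ η₀ ∧ a * η ^ (1 - α) ≤ 1 / 2 := by
  have hc : Continuous fun η : ℝ => a * η ^ (1 - α) :=
    (continuous_id.rpow_const fun _ => Or.inr (by linarith)).const_mul a
  have h1 := (hc.continuousAt (x := 0)).eventually_lt_const (u := 1 / 2) (by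
    simp only
    rw [Real.zero_rpow (by linarith)]; norm_num)
  have h2 : ∀ᶠ η in 𝓝[>] (0 : ℝ), 0 < η ∧ η < η₀ := Ioo_mem_nhdsGT hη₀
  obtain ⟨η, ⟨h, h'⟩, hb⟩ := (h2.and (h1.filter_mono nhdsWithin_le_nhds)).exists
  exact ⟨η, h, h'.le, hb.le⟩

/-- Thanks to `abs_revOrderStat_sub_le` it suffices to control the unsorted variables, so which of
them are the largest need not be known. -/
theorem scaledOrderStats_close {n K : ℕ} (hn : 0 < n) (hKn : K ≤ n) {x : Fin n → ℕ} {y : DecSeq}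
    (hy : ∀ j, K ≤ j → y.1 j = 0) {η : ℝ} (hη : 0 ≤ η)
    (h : ∀ i : Fin n, |(x i : ℝ) - y.1 i * (n : ℝ) ^ γ| ≤ η * (n : ℝ) ^ γ) (j : ℕ) :
    |((scaledOrderStats γ x).1 j : ℝ) - y.1 j| ≤ η := by
  have hn' : (0 : ℝ) < n := by exact_mod_cast hn
  have hr0 : 0 < (n : ℝ) ^ γ := by positivity
  rw [coe_scaledOrderStats]
  by_cases hj : j < n
  · have hanti : Antitone fun j => (y.1 j : ℝ) * (n : ℝ) ^ γ := fun i j hij => by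
      have : (y.1 j : ℝ) ≤ y.1 i := by exact_mod_cast y.2 hij
      dsimp only
      gcongr
    have := abs_revOrderStat_sub_le x hanti h ⟨j, hj⟩
    have e : (revOrderStat x j : ℝ) / (n : ℝ) ^ γ - y.1 j =
        ((revOrderStat x j : ℝ) - y.1 j * (n : ℝ) ^ γ) / (n : ℝ) ^ γ := by field_simp
    rw [e, abs_div, abs_of_pos hr0, div_le_iff₀ hr0]
    exact this
  · rw [hy j (by omega), revOrderStat, dif_neg hj]
    simpa using hη

theorem IsStretchedExpLaw.measure_open_ge [IsProbabilityMeasure P] (h : IsStretchedExpLaw α c μ v)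
    (hX : ∀ i, Measurable (X i)) (hindep : iIndepFun X P)
    (hlaw : ∀ i k, P {ω | X i ω = k} = ENNReal.ofReal (c * Real.exp (-(k : ℝ) ^ α)))
    (hγ : γ = 1 / (2 - α)) {sn : ℕ → ℝ} (hsn : Tendsto sn atTop (𝓝 s))
    (hint : ∀ n : ℕ, 1 ≤ n → ∃ N : ℕ, μ * n + sn n * (n : ℝ) ^ γ = N) {O : Set DecSeq}
    (hO : IsOpen O) {x : DecSeq} (hx : x ∈ O) {L : ℝ} (hL : energy α v s x < ENNReal.ofReal L) :
    ∀ᶠ n : ℕ in atTop, ENNReal.ofReal (Real.exp (-((n : ℝ) ^ (γ * α) * L))) ≤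
      P {ω | ((∑ i ∈ Finset.range n, X i ω : ℕ) : ℝ) = μ * n + sn n * (n : ℝ) ^ γ ∧
        scaledOrderStats γ (fun i : Fin n => X i ω) ∈ O} := by
  have hα0 := h.alpha_pos
  have hα1 := h.alpha_lt_one
  have hv := h.var_pos
  have hc := h.c_pos
  obtain ⟨y, hyO, K, hyK, hyL⟩ := exists_truncation_lt hα0 hv hL hO hx
  obtain ⟨η₀, hη₀, hball⟩ := exists_uniform_nhd hO hyO
  set A := ∑ j ∈ Finset.range K, (y.1 j : ℝ) ^ α with hA
  set Sy := ∑ j ∈ Finset.range K, (y.1 j : ℝ) with hSy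
  obtain ⟨ζ, hζ, hζη, hζL⟩ := exists_window_width hα0 hη₀ hyL
  -- Aiming `2 * ζ` too low leaves a deficit of `2 * ζ * r`, up to `ζ * r` for the window and `ζ *
  -- r` for rounding and centring. It lies in `[0, 4 * ζ * r]`, the range of the adjusting variable.
  set u := s - Sy - 2 * ζ with hu
  obtain ⟨η, hη, hηη₀, hηu⟩ := exists_truncation_level hα1 (|u| / v + ζ / v) hη₀
  -- Half of the slack goes to the window estimate, half to the constant `c ^ (K + 1)`.
  set ε := (L - (A + (4 * ζ) ^ α + (u ^ 2 / (2 * v) + |u| / v * ζ))) / 2 with hε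
  have hε0 : 0 < ε := by rw [hε]; linarith
  have hwin := h.measure_window_ge hX hindep hlaw hγ hζ hη hηu (K + 1) hε0
  have hr := tendsto_scale hα1 hγ
  have hV := tendsto_speed hα0 hα1 hγ
  have hcen : ∀ᶠ n : ℕ in atTop, |sn n - s| + (K + |μ| * (K + 1)) * ((n : ℝ) ^ γ)⁻¹ ≤ ζ := by
    have h1 : Tendsto (fun n : ℕ => |sn n - s| + (K + |μ| * (K + 1)) * ((n : ℝ) ^ γ)⁻¹) atTop
        (𝓝 (|s - s| + (K + |μ| * (K + 1)) * 0)) :=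
      (hsn.sub_const s).abs.add (hr.inv_tendsto_atTop.const_mul _)
    exact h1.eventually_le_const (by simpa using hζ)
  have hcpow : ∀ᶠ n : ℕ in atTop, (c ^ (K + 1))⁻¹ ≤ Real.exp ((n : ℝ) ^ (γ * α) * ε) :=
    (Real.tendsto_exp_atTop.comp (hV.atTop_mul_const hε0)).eventually_ge_atTop _
  filter_upwards [hwin, hcen, hcpow, hr.eventually_ge_atTop (1 / η₀), eventually_gt_atTop K]
    with n hw hce hcp hrη hKn
  have hn0 : 0 < n := by omega
  have hn' : (0 : ℝ) < n := by exact_mod_cast hn0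
  obtain ⟨N, hN⟩ := hint n hn0
  have hrV := natCast_rpow_rpow (α := α) (γ := γ) n
  rw [hN]
  set r : ℝ := (n : ℝ) ^ γ with hrdef
  set V : ℝ := (n : ℝ) ^ (γ * α) with hVdef
  have hr0 : 0 < r := by positivity
  have hV0 : 0 < V := by positivity
  have hrη1 : 1 ≤ η₀ * r := by rw [div_le_iff₀ hη₀] at hrη; linarith
  set k : ℕ → ℕ := fun i => ⌊(y.1 i : ℝ) * r⌋₊ with hk
  have hyr : ∀ i, 0 ≤ (y.1 i : ℝ) * r := fun i => mul_nonneg (y.1 i).coe_nonneg hr0.le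
  have hk1 : ∀ i, (k i : ℝ) ≤ y.1 i * r := fun i => Nat.floor_le (hyr i)
  have hk2 : ∀ i, (y.1 i : ℝ) * r ≤ k i + 1 := fun i => (Nat.lt_floor_add_one _).le
  set D : ℕ := ⌊4 * ζ * r⌋₊ with hD
  have hD1 : (D : ℝ) ≤ 4 * ζ * r := Nat.floor_le (by positivity)
  obtain ⟨R, hR⟩ : ∃ R, R = Finset.Ico (K + 1) n := ⟨_, rfl⟩
  rw [← hR] at hw
  set W : Set (R → ℕ) := {z | (∀ i, (z i : ℝ) ≤ η * r) ∧ (u - ζ) * r ≤ ∑ i, ((z i : ℝ) - μ) ∧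
    ∑ i, ((z i : ℝ) - μ) ≤ (u + ζ) * r} with hW
  have hWω : {ω | (fun i : R => X i ω) ∈ W} = {ω | (∀ i ∈ R, (X i ω : ℝ) ≤ η * r) ∧
      (u - ζ) * r ≤ ∑ i ∈ R, ((X i ω : ℝ) - μ) ∧ ∑ i ∈ R, ((X i ω : ℝ) - μ) ≤ (u + ζ) * r} := by
    ext ω
    have e := Finset.sum_coe_sort R fun i => (X i ω : ℝ) - μ
    simp only [hW, Set.mem_ofPred_eq, e, Subtype.forall]
  have hcard : (Fintype.card R : ℝ) = n - (K + 1) := by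
    rw [Fintype.card_coe, hR, Nat.card_Ico, Nat.cast_sub (by omega)]
    push_cast; ring
  have hfill : ∀ z ∈ W, ∃ d ≤ D, ∑ i ∈ Finset.range K, k i + d + ∑ i, z i = N := by
    rintro z ⟨-, hz1, hz2⟩
    rw [Finset.sum_sub_distrib] at hz1 hz2
    simp only [Finset.sum_const, Finset.card_univ, nsmul_eq_mul, hcard] at hz1 hz2
    have hce' : |sn n - s| * r + (K + |μ| * (K + 1)) ≤ ζ * r := by
      have := mul_le_mul_of_nonneg_right hce hr0.le
      rwa [add_mul, mul_assoc, inv_mul_cancel₀ hr0.ne', mul_one] at this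
    have ha := abs_le.mp (le_refl |sn n - s|)
    have hb := abs_le.mp (le_refl |μ|)
    have hb1 : μ * (K + 1) ≤ |μ| * (K + 1) := by gcongr; exact hb.2
    have hb2 : -|μ| * (K + 1) ≤ μ * (K + 1) := by gcongr; exact hb.1
    have ha1 : (sn n - s) * r ≤ |sn n - s| * r := by gcongr; exact ha.2
    have ha2 : -|sn n - s| * r ≤ (sn n - s) * r := by gcongr; exact ha.1
    have hs1 : ∑ i ∈ Finset.range K, (k i : ℝ) ≤ Sy * r := by
      rw [hSy, Finset.sum_mul]; exact Finset.sum_le_sum fun i _ => hk1 i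
    have hs2 : Sy * r ≤ ∑ i ∈ Finset.range K, (k i : ℝ) + K := by
      rw [hSy, Finset.sum_mul]
      calc ∑ i ∈ Finset.range K, (y.1 i : ℝ) * r ≤ ∑ i ∈ Finset.range K, ((k i : ℝ) + 1) :=
            Finset.sum_le_sum fun i _ => hk2 i
        _ = _ := by simp [Finset.sum_add_distrib]
    have hlow : (∑ i ∈ Finset.range K, (k i : ℝ)) + ∑ i, (z i : ℝ) ≤ N := by
      rw [← hN]
      rw [hu] at hz2
      linarith
    have hup : (N : ℝ) ≤ (∑ i ∈ Finset.range K, (k i : ℝ)) + ∑ i, (z i : ℝ) + 4 * ζ * r := by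
      rw [← hN]
      rw [hu] at hz1
      linarith
    have hlow' : ∑ i ∈ Finset.range K, k i + ∑ i, z i ≤ N := by exact_mod_cast hlow
    refine ⟨N - (∑ i ∈ Finset.range K, k i + ∑ i, z i), Nat.le_floor ?_, by omega⟩
    rw [Nat.cast_sub hlow']
    push_cast
    linarith
  have hmain := measure_prescribed_sum_ge hc hα0 hX hindep hlaw hKn hR k W hfill
  refine le_trans ?_ (hmain.trans (measure_mono ?_))
  · rw [hWω, ← ofReal_measureReal (μ := P), ← ENNReal.ofReal_prod_of_nonneg fun i _ => by positivity,
      ← ENNReal.ofReal_mul (Finset.prod_nonneg fun i _ => by positivity),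
      ← ENNReal.ofReal_mul (mul_nonneg (Finset.prod_nonneg fun i _ => by positivity) (by positivity))]
    apply ENNReal.ofReal_le_ofReal
    have hp1 : c ^ K * Real.exp (-(V * A)) ≤
        ∏ i ∈ Finset.range K, (c * Real.exp (-(k i : ℝ) ^ α)) := by
      have e : c ^ K * Real.exp (-(V * A)) =
          ∏ i ∈ Finset.range K, (c * Real.exp (-(((y.1 i : ℝ) * r) ^ α))) := by
        rw [Finset.prod_mul_distrib, Finset.prod_const, Finset.card_range, ← Real.exp_sum, hA,
          Finset.mul_sum, Finset.sum_neg_distrib]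
        congr 3
        refine Finset.sum_congr rfl fun i _ => ?_
        rw [Real.mul_rpow (y.1 i).coe_nonneg hr0.le, hrV, mul_comm]
      rw [e]
      refine Finset.prod_le_prod (fun i _ => by positivity) fun i _ => ?_
      have := hk1 i
      gcongr
    have hp2 : c * Real.exp (-(V * (4 * ζ) ^ α)) ≤ c * Real.exp (-(D : ℝ) ^ α) := by
      have : (D : ℝ) ^ α ≤ V * (4 * ζ) ^ α := by
        rw [← hrV, mul_comm, ← Real.mul_rpow (by positivity) hr0.le]
        exact Real.rpow_le_rpow (Nat.cast_nonneg D) hD1 hα0.le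
      gcongr
    calc Real.exp (-(V * L))
        ≤ Real.exp (-(V * L)) * (c ^ (K + 1) * Real.exp (V * ε)) := by
          refine le_mul_of_one_le_right (Real.exp_pos _).le ?_
          rwa [inv_le_iff_one_le_mul₀' (by positivity)] at hcp
      _ = c ^ K * Real.exp (-(V * A)) * (c * Real.exp (-(V * (4 * ζ) ^ α))) *
          Real.exp (-(V * (u ^ 2 / (2 * v) + |u| / v * ζ + ε))) := by
          have e : -(V * L) + V * ε = -(V * A) + -(V * (4 * ζ) ^ α) +
              -(V * (u ^ 2 / (2 * v) + |u| / v * ζ + ε)) := by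
            have : L = 2 * ε + (A + (4 * ζ) ^ α + (u ^ 2 / (2 * v) + |u| / v * ζ)) := by
              rw [hε]; ring
            rw [this]; ring
          have e' : Real.exp (-(V * L)) * Real.exp (V * ε) = Real.exp (-(V * A)) *
              Real.exp (-(V * (4 * ζ) ^ α)) * Real.exp (-(V * (u ^ 2 / (2 * v) + |u| / v * ζ + ε))) := by
            rw [← Real.exp_add, ← Real.exp_add, ← Real.exp_add, e]
          rw [pow_succ]
          linear_combination c ^ K * c * e'
      _ ≤ _ := by gcongr
  · rintro ω ⟨h1, h2, h3, h4⟩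
    have h3' : ∀ i ∈ R, (X i ω : ℝ) ≤ η * r := fun i hi => h3.1 ⟨i, hi⟩
    refine ⟨by rw [h4], hball _ (scaledOrderStats_close hn0 hKn.le hyK hη₀.le fun i => ?_)⟩
    rw [← hrdef]
    -- Prescribed entries err by rounding, at most `1 ≤ η₀ * r`; the adjusting variable is at most
    -- `4 * ζ * r`, and the bulk at most `η * r`.
    rcases lt_trichotomy (i : ℕ) K with hi | hi | hi
    · rw [h1 i (Finset.mem_range.mpr hi), abs_le]
      constructor
      · linarith [hk2 i]
      · linarith [hk1 i]
    · rw [hyK i hi.ge, hi]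
      have : (X K ω : ℝ) ≤ D := by exact_mod_cast h2
      simp only [NNReal.coe_zero, zero_mul, sub_zero, Nat.abs_cast]
      calc (X K ω : ℝ) ≤ 4 * ζ * r := this.trans hD1
        _ ≤ η₀ * r := by gcongr
    · rw [hyK i hi.le]
      simp only [NNReal.coe_zero, zero_mul, sub_zero, Nat.abs_cast]
      calc (X i ω : ℝ) ≤ η * r := h3' i (by rw [hR, Finset.mem_Ico]; exact ⟨hi, i.2⟩)
        _ ≤ η₀ * r := by gcongr

end LowerBound

/-! ### Moments of the law and the conditional distributions -/

section Law

variable {Ω : Type*} [MeasurableSpace Ω] {P : Measure Ω} {α c μ v γ s : ℝ} {X : ℕ → Ω → ℕ}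

theorem hasSum_integral_of_law [IsProbabilityMeasure P] (hc : 0 < c) (hX : ∀ i, Measurable (X i))
    (hlaw : ∀ i k, P {ω | X i ω = k} = ENNReal.ofReal (c * Real.exp (-(k : ℝ) ^ α)))
    {g : ℕ → ℝ} (hg : Summable fun k : ℕ => c * Real.exp (-(k : ℝ) ^ α) * |g k|) (i : ℕ) :
    HasSum (fun k : ℕ => c * Real.exp (-(k : ℝ) ^ α) * g k) (∫ ω, g (X i ω) ∂P) := by
  have hmass : ∀ k : ℕ, (P.map (X i)) {k} = ENNReal.ofReal (c * Real.exp (-(k : ℝ) ^ α)) := fun k => by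
    rw [Measure.map_apply (hX i) (measurableSet_singleton k), ← hlaw i k]; rfl
  have hreal : ∀ k : ℕ, ((P.map (X i)) {k}).toReal = c * Real.exp (-(k : ℝ) ^ α) := fun k => by
    rw [hmass, ENNReal.toReal_ofReal (by positivity)]
  have h1 := hasSum_integral_sum_dirac (f := g) (x := fun k : ℕ => k)
    (c := fun k => (P.map (X i)) {k}) (fun k => by rw [hmass]; exact ENNReal.ofReal_ne_top)
    (by simpa only [hreal, Real.norm_eq_abs] using hg)
  rw [Measure.sum_smul_dirac, integral_map (hX i).aemeasurable
    (measurable_of_countable g).aestronglyMeasurable] at h1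
  simpa only [hreal, smul_eq_mul] using h1

theorem isStretchedExpLaw_of_law [IsProbabilityMeasure P] (hα0 : 0 < α) (hα1 : α < 1)
    (hc : c = 1 / ∑' k : ℕ, Real.exp (-(k : ℝ) ^ α)) (hX : ∀ i, Measurable (X i))
    (hlaw : ∀ i k, P {ω | X i ω = k} = ENNReal.ofReal (c * Real.exp (-(k : ℝ) ^ α)))
    (hμ : μ = ∫ ω, (X 0 ω : ℝ) ∂P) (hv : v = variance (fun ω => (X 0 ω : ℝ)) P) :
    IsStretchedExpLaw α c μ v := by
  have hs := fun (m : ℝ) (j : ℕ) =>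
    summable_add_pow_mul_exp_neg_rpow (κ := 1) hα0 one_pos m j
  simp only [neg_mul, one_mul] at hs
  have hs0 : Summable fun k : ℕ => Real.exp (-(k : ℝ) ^ α) := by simpa using hs 0 0
  have hcpos : 0 < c := by
    rw [hc]
    exact one_div_pos.mpr (hs0.tsum_pos (fun k => (Real.exp_pos _).le) 0 (Real.exp_pos _))
  have hmass : HasSum (fun k : ℕ => c * Real.exp (-(k : ℝ) ^ α)) 1 := by
    have := hasSum_integral_of_law (g := fun _ => 1) hcpos hX hlaw
      (by simpa using hs0.mul_left c) 0
    simpa using this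
  have hmean1 : HasSum (fun k : ℕ => c * Real.exp (-(k : ℝ) ^ α) * k) μ := by
    rw [hμ]
    refine hasSum_integral_of_law (g := fun k => (k : ℝ)) hcpos hX hlaw ?_ 0
    refine ((hs 0 1).mul_left c).congr fun k => ?_
    rw [Nat.abs_cast, add_zero, pow_one]; ring
  have hmean : HasSum (fun k : ℕ => c * Real.exp (-(k : ℝ) ^ α) * (k - μ)) 0 := by
    have := hmean1.sub (hmass.mul_right μ)
    rw [one_mul, sub_self] at this
    simpa only [← mul_sub] using this
  have hvar : HasSum (fun k : ℕ => c * Real.exp (-(k : ℝ) ^ α) * (k - μ) ^ 2) v := by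
    have hXm : AEMeasurable (fun ω => (X 0 ω : ℝ)) P :=
      ((measurable_of_countable (fun k : ℕ => (k : ℝ))).comp (hX 0)).aemeasurable
    rw [hv, variance_eq_integral hXm, ← hμ]
    refine hasSum_integral_of_law (g := fun k => ((k : ℝ) - μ) ^ 2) hcpos hX hlaw ?_ 0
    refine ((hs (-μ) 2).mul_left c).congr fun k => ?_
    rw [abs_of_nonneg (sq_nonneg _), ← sub_eq_add_neg]; ring
  refine ⟨hα0, hα1, hcpos, ?_, hmass, hmean, hvar⟩
  have hle : ∀ k : ℕ, c * Real.exp (-(k : ℝ) ^ α) * (k - μ) ^ 2 ≤ v := fun k =>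
    le_hasSum hvar k fun j _ => by positivity
  -- Positivity of the variance: one of the atoms `0` and `1` differs from the mean.
  by_cases h0 : μ = 0
  · refine lt_of_lt_of_le ?_ (hle 1)
    rw [h0]
    simpa using mul_pos hcpos (Real.exp_pos _)
  · refine lt_of_lt_of_le ?_ (hle 0)
    have : 0 < ((0 : ℕ) - μ) ^ 2 := by
      rw [Nat.cast_zero, zero_sub]; exact sq_pos_of_ne_zero (neg_ne_zero.mpr h0)
    positivity

theorem measurable_scaledOrderStats (hX : ∀ i, Measurable (X i)) (γ : ℝ) (n : ℕ) :
    Measurable fun ω => scaledOrderStats γ (fun i : Fin n => X i ω) :=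
  (measurable_of_countable fun x : Fin n → ℕ => scaledOrderStats γ x).comp
    (measurable_pi_lambda _ fun i : Fin n => hX i)

theorem measurableSet_sum_eq (hX : ∀ i, Measurable (X i)) (n : ℕ) (b : ℝ) :
    MeasurableSet {ω | ((∑ i ∈ Finset.range n, X i ω : ℕ) : ℝ) = b} :=
  measurableSet_eq_fun ((measurable_of_countable (fun k : ℕ => (k : ℝ))).comp
    (Finset.measurable_sum _ fun i _ => hX i)) measurable_const

theorem map_cond_apply (hX : ∀ i, Measurable (X i)) (γ : ℝ) (n : ℕ) (b : ℝ) {A : Set DecSeq}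
    (hA : MeasurableSet A) :
    (Measure.map (fun ω => scaledOrderStats γ (fun i : Fin n => X i ω))
        (cond P {ω | ((∑ i ∈ Finset.range n, X i ω : ℕ) : ℝ) = b})) A =
      (P {ω | ((∑ i ∈ Finset.range n, X i ω : ℕ) : ℝ) = b})⁻¹ *
        P {ω | ((∑ i ∈ Finset.range n, X i ω : ℕ) : ℝ) = b ∧
          scaledOrderStats γ (fun i : Fin n => X i ω) ∈ A} := by
  rw [Measure.map_apply (measurable_scaledOrderStats hX γ n) hA,
    cond_apply (measurableSet_sum_eq hX n b)]
  rfl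

end Law

/-! ### Passage to logarithms and the conditioning event -/

theorem inv_mul_log_le {V a : ℝ} (hV : 0 < V) {q : ℝ≥0∞}
    (h : q ≤ ENNReal.ofReal (Real.exp (-(V * a)))) :
    ((1 / V : ℝ) : EReal) * ENNReal.log q ≤ ((-a : ℝ) : EReal) := by
  have h1 := ENNReal.log_le_log h
  rw [ENNReal.log_ofReal_of_pos (Real.exp_pos _), Real.log_exp] at h1
  refine (mul_le_mul_of_nonneg_left h1 (by exact_mod_cast (one_div_pos.mpr hV).le)).trans ?_
  rw [← EReal.coe_mul]
  apply le_of_eq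
  congr 1
  field_simp

theorem le_inv_mul_log {V a : ℝ} (hV : 0 < V) {q : ℝ≥0∞}
    (h : ENNReal.ofReal (Real.exp (-(V * a))) ≤ q) :
    ((-a : ℝ) : EReal) ≤ ((1 / V : ℝ) : EReal) * ENNReal.log q := by
  have h1 := ENNReal.log_le_log h
  rw [ENNReal.log_ofReal_of_pos (Real.exp_pos _), Real.log_exp] at h1
  refine le_trans ?_ (mul_le_mul_of_nonneg_left h1 (by exact_mod_cast (one_div_pos.mpr hV).le))
  rw [← EReal.coe_mul]
  apply le_of_eq
  congr 1
  field_simp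

section Conditioned

variable {Ω : Type*} [MeasurableSpace Ω] {P : Measure Ω} [IsProbabilityMeasure P]
  {α c μ v γ s : ℝ} {X : ℕ → Ω → ℕ}

/-- The open-set bound on the whole space, at a point of almost minimal energy. In particular the
conditioning event eventually has positive probability. -/
theorem IsStretchedExpLaw.measure_sum_ge (h : IsStretchedExpLaw α c μ v)
    (hX : ∀ i, Measurable (X i)) (hindep : iIndepFun X P)
    (hlaw : ∀ i k, P {ω | X i ω = k} = ENNReal.ofReal (c * Real.exp (-(k : ℝ) ^ α)))
    (hγ : γ = 1 / (2 - α)) {sn : ℕ → ℝ} (hsn : Tendsto sn atTop (𝓝 s))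
    (hint : ∀ n : ℕ, 1 ≤ n → ∃ N : ℕ, μ * n + sn n * (n : ℝ) ^ γ = N) {ε : ℝ} (hε : 0 < ε) :
    ∀ᶠ n : ℕ in atTop, ENNReal.ofReal (Real.exp (-((n : ℝ) ^ (γ * α) *
        ((⨅ y, energy α v s y).toReal + ε)))) ≤
      P {ω | ((∑ i ∈ Finset.range n, X i ω : ℕ) : ℝ) = μ * n + sn n * (n : ℝ) ^ γ} := by
  have hfin := iInf_energy_ne_top (s := s) h.alpha_pos h.var_pos
  have hlt : ⨅ y, energy α v s y < ENNReal.ofReal ((⨅ y, energy α v s y).toReal + ε) := by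
    rw [ENNReal.lt_ofReal_iff_toReal_lt hfin]; linarith
  obtain ⟨x, hx⟩ := iInf_lt_iff.mp hlt
  filter_upwards [h.measure_open_ge hX hindep hlaw hγ hsn hint isOpen_univ (Set.mem_univ x) hx]
    with n hn
  exact hn.trans (measure_mono fun ω hω => hω.1)

theorem IsStretchedExpLaw.measure_sum_le (h : IsStretchedExpLaw α c μ v)
    (hX : ∀ i, Measurable (X i)) (hindep : iIndepFun X P)
    (hlaw : ∀ i k, P {ω | X i ω = k} = ENNReal.ofReal (c * Real.exp (-(k : ℝ) ^ α)))
    (hγ : γ = 1 / (2 - α)) {sn : ℕ → ℝ} (hsn : Tendsto sn atTop (𝓝 s)) {ε : ℝ} (hε : 0 < ε) :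
    ∀ᶠ n : ℕ in atTop,
      P {ω | ((∑ i ∈ Finset.range n, X i ω : ℕ) : ℝ) = μ * n + sn n * (n : ℝ) ^ γ} ≤
      ENNReal.ofReal (Real.exp (-((n : ℝ) ^ (γ * α) * ((⨅ y, energy α v s y).toReal - ε)))) := by
  have hfin := iInf_energy_ne_top (s := s) h.alpha_pos h.var_pos
  set I := ⨅ y, energy α v s y with hI
  -- The closed-set bound needs a nonnegative level; when the infimum is at most `ε` the claim is
  -- weaker than `P ≤ 1`.
  rcases le_total I.toReal ε with hle | hle
  · refine Eventually.of_forall fun n => prob_le_one.trans ?_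
    rw [ENNReal.one_le_ofReal]
    apply Real.one_le_exp
    have : 0 ≤ (n : ℝ) ^ (γ * α) := by positivity
    nlinarith
  · have hlt : ENNReal.ofReal (I.toReal - ε / 2) < I := by
      rw [ENNReal.ofReal_lt_iff_lt_toReal (by linarith) hfin]; linarith
    filter_upwards [h.measure_closed_le hX hindep hlaw hγ hsn isClosed_univ (L := I.toReal - ε / 2)
      (by linarith) (fun x _ => hlt.trans_le (iInf_le _ x)) (half_pos hε)] with n hn
    have e : I.toReal - ε = I.toReal - ε / 2 - ε / 2 := by ring
    rw [e]
    refine le_trans (measure_mono ?_) hn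
    exact fun ω hω => ⟨hω, Set.mem_univ _⟩

end Conditioned

/-! ### The conditional large deviation principle -/

theorem theorem2p2 {Ω : Type*} [MeasurableSpace Ω] (P : Measure Ω) [IsProbabilityMeasure P]
    (α : ℝ) (hα0 : 0 < α) (hα1 : α < 1)
    (c : ℝ) (hc : c = 1 / ∑' k : ℕ, Real.exp (-(k : ℝ) ^ α))
    (X : ℕ → Ω → ℕ) (hX : ∀ i, Measurable (X i)) (hindep : iIndepFun X P)
    (hlaw : ∀ i k, P {ω | X i ω = k} = ENNReal.ofReal (c * Real.exp (-(k : ℝ) ^ α)))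
    (μ : ℝ) (hμ : μ = ∫ ω, (X 0 ω : ℝ) ∂P)
    (σ : ℝ) (hσ : σ ^ 2 = variance (fun ω => (X 0 ω : ℝ)) P)
    (γ : ℝ) (hγ : γ = 1 / (2 - α))
    (s : ℝ) (sn : ℕ → ℝ) (hsn : Tendsto sn atTop (𝓝 s))
    (hint : ∀ n : ℕ, 1 ≤ n → ∃ N : ℕ, μ * n + sn n * (n : ℝ) ^ γ = N) :
    SatisfiesLDP
      (fun n => Measure.map (fun ω => scaledOrderStats γ (fun i : Fin n => X i ω))
        (cond P {ω | ((∑ i ∈ Finset.range n, X i ω : ℕ) : ℝ) = μ * n + sn n * (n : ℝ) ^ γ}))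
      (fun n => (n : ℝ) ^ (γ * α))
      (fun x => energy α (σ ^ 2) s x - ⨅ y, energy α (σ ^ 2) s y) := by
  have h := isStretchedExpLaw_of_law hα0 hα1 hc hX hlaw hμ hσ
  set v := σ ^ 2
  have hfin := iInf_energy_ne_top (s := s) hα0 h.var_pos
  set I := ⨅ y, energy α v s y with hI
  have hadd : ∀ a : ℝ, 0 ≤ a → ENNReal.ofReal (a + I.toReal) = ENNReal.ofReal a + I := fun a ha => by
    rw [ENNReal.ofReal_add ha ENNReal.toReal_nonneg, ENNReal.ofReal_toReal hfin]
  have hV := tendsto_speed hα0 hα1 hγ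
  refine ⟨hV, ?_, fun a => ?_, fun A hA => ?_, fun O hO => ?_⟩
  · rw [lowerSemicontinuous_iff_isClosed_preimage]
    intro b
    convert isClosed_energy_le (s := s) hα0 hα1 h.var_pos (b + I) using 1
    ext x
    simp [tsub_le_iff_right]
  · convert isCompact_energy_le (s := s) hα0 hα1 h.var_pos
      (ENNReal.add_ne_top.mpr ⟨ENNReal.coe_ne_top, hfin⟩ : (a : ℝ≥0∞) + I ≠ ⊤) using 1
    ext x
    simp [tsub_le_iff_right]
  · refine EReal.le_of_forall_lt_iff_le.1 fun z hz => ?_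
    refine limsup_le_of_le (by isBoundedDefault) ?_
    rw [EReal.neg_lt_comm, ← EReal.coe_neg] at hz
    -- A positive bound `z` is trivial for subprobabilities; for `z ≤ 0` the intermediate level `a'`
    -- exceeds `-z ≥ 0`, as the closed-set bound requires.
    rcases lt_or_ge 0 z with hz0 | hz0
    · filter_upwards [hV.eventually_gt_atTop 0] with n hVn
      refine (inv_mul_log_le (a := 0) hVn ?_).trans (by exact_mod_cast (by simpa using hz0.le))
      rw [mul_zero, neg_zero, Real.exp_zero, ENNReal.ofReal_one, map_cond_apply hX γ n _ hA.measurableSet]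
      refine (mul_le_mul' le_rfl (measure_mono ?_)).trans (ENNReal.inv_mul_le_one
        (P {ω | ((∑ i ∈ Finset.range n, X i ω : ℕ) : ℝ) = μ * n + sn n * (n : ℝ) ^ γ}))
      exact fun ω hω => hω.1
    · obtain ⟨a', ha1, ha2⟩ := EReal.lt_iff_exists_real_btwn.mp hz
      rw [EReal.coe_lt_coe_iff] at ha1
      have ha'0 : 0 ≤ a' := by linarith
      have hx : ∀ x ∈ A, ENNReal.ofReal (a' + I.toReal) < energy α v s x := by
        intro x hxA
        have h1 : (a' : EReal) < ((energy α v s x - I : ℝ≥0∞) : EReal) :=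
          ha2.trans_le (iInf₂_le x hxA)
        rw [hadd a' ha'0, ← lt_tsub_iff_right, ← EReal.coe_ennreal_lt_coe_ennreal_iff,
          EReal.coe_ennreal_ofReal, max_eq_left ha'0]
        exact h1
      -- Numerator and denominator each lose `ε`, and `a' - 2 * ε = -z`.
      set ε := (a' + z) / 2 with hε
      have hε0 : 0 < ε := by rw [hε]; linarith
      filter_upwards [h.measure_closed_le hX hindep hlaw hγ hsn hA
        (add_nonneg ha'0 ENNReal.toReal_nonneg) hx hε0,
        h.measure_sum_ge hX hindep hlaw hγ hsn hint hε0, hV.eventually_gt_atTop 0] with n h1 h2 hVn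
      have hz' : (z : EReal) = ((-(-z) : ℝ) : EReal) := by rw [neg_neg]
      rw [hz']
      refine inv_mul_log_le hVn ?_
      rw [map_cond_apply hX γ n _ hA.measurableSet]
      refine (mul_le_mul' (ENNReal.inv_le_inv.mpr h2) h1).trans (le_of_eq ?_)
      rw [← ENNReal.ofReal_inv_of_pos (Real.exp_pos _), ← Real.exp_neg,
        ← ENNReal.ofReal_mul (Real.exp_pos _).le, ← Real.exp_add]
      congr 2
      rw [hε]; ring
  · refine EReal.ge_of_forall_gt_iff_ge.1 fun z hz => ?_
    refine le_liminf_of_le (by isBoundedDefault) ?_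
    rw [EReal.lt_neg_comm, ← EReal.coe_neg] at hz
    obtain ⟨x, hxlt⟩ := iInf_lt_iff.mp hz
    obtain ⟨hxO, hxlt⟩ := iInf_lt_iff.mp hxlt
    obtain ⟨a', ha1, ha2⟩ := EReal.lt_iff_exists_real_btwn.mp hxlt
    rw [EReal.coe_lt_coe_iff] at ha2
    have ha'0 : 0 ≤ a' := by
      have : (0 : EReal) ≤ a' := (EReal.coe_ennreal_nonneg _).trans ha1.le
      exact_mod_cast this
    have hx : energy α v s x < ENNReal.ofReal (a' + I.toReal) := by
      rw [hadd a' ha'0]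
      refine (ENNReal.sub_lt_iff_lt_right hfin (iInf_le _ x)).mp ?_
      rw [← EReal.coe_ennreal_lt_coe_ennreal_iff, EReal.coe_ennreal_ofReal, max_eq_left ha'0]
      exact ha1
    -- Here only the denominator loses `ε`, and `a' + ε = -z`.
    set ε := -z - a' with hε
    have hε0 : 0 < ε := by rw [hε]; linarith
    filter_upwards [h.measure_open_ge hX hindep hlaw hγ hsn hint hO hxO hx,
      h.measure_sum_le hX hindep hlaw hγ hsn hε0, hV.eventually_gt_atTop 0] with n h1 h2 hVn
    have hz' : (z : EReal) = ((-(-z) : ℝ) : EReal) := by rw [neg_neg]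
    rw [hz']
    refine le_inv_mul_log hVn ?_
    rw [map_cond_apply hX γ n _ hO.measurableSet]
    refine le_trans (le_of_eq ?_) (mul_le_mul' (ENNReal.inv_le_inv.mpr h2) h1)
    rw [← ENNReal.ofReal_inv_of_pos (Real.exp_pos _), ← Real.exp_neg,
      ← ENNReal.ofReal_mul (Real.exp_pos _).le, ← Real.exp_add]
    congr 2
    rw [hε]; ring
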